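/- Let $(Z,d)$ be a compact, connected metric space carrying a Borel regular measure $\mu$ that is Ahlfors $Q$-regular for some $Q>1$, i.e. there are $c,C>0$ with $c\,r^Q\le\mu(B(z,r))\le C\,r^Q$ for all $z\in Z$ and $0<r\le\operatorname{diam}Z$. Suppose that for some $1\le p\le Q$ there is a family $\Gamma$ of nonconstant paths in $Z$ with $\operatorname{mod}_p(\Gamma)>0$. Here a path is a continuous map from an interval into $Z$, and $\operatorname{mod}_p(\Gamma)=\inf\int_Z\rho^p\,d\mu$, where the infimum is over all Borel $\rho\colon Z\to[0,\infty]$ with $\int_\gamma\rho\ge 1$ (arclength integral) for every rectifiable $\gamma\in\Gamma$. A hyperbolic filling $X=(V,E)$ of $Z$ is constructed as follows. Fix $s>1$ and $R>\operatorname{diam}Z$; for each integer $k\ge 0$ choose a maximal set $P_k\subseteq Z$ whose distinct points have mutual distance at least $Rs^{-k}$. The vertex set $V$ is the disjoint union of the $P_k$; a vertex $v$ given by $x\in P_k$ has level $k$, center $x$, and ball $B_v=B(x,2Rs^{-k})$. Distinct vertices are joined by an edge iff their levels differ by at most $1$ and $\overline{B_v}\cap\overline{B_w}\ne\emptyset$.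 A sequence of vertices with centers $x_n$ and radii $r_n$ converges nontangentially to $z\in Z$ if $x_n\to z$, $r_n\to0$ and, for some $C>0$, $d(z,x_n)\le C r_n$ for all $n$. For sets $A,B\subseteq Z$, a function $\tau\colon E\to[0,\infty]$ is admissible if $\sum_{e\in\gamma}\tau(e)\ge1$ for every bi-infinite path $\gamma$ in $X$ whose two ends converge nontangentially to a point of $A$ and to a point of $B$, respectively. For $q>0$ put $\operatorname{wcap}_q(A,B)=\inf\{\|\tau\|_{q,\infty}^q:\tau\text{ admissible}\}$, where $\|\tau\|_{q,\infty}$ is the infimum of all $C>0$ with $\#\{e:\tau(e)>\lambda\}\le C^q/\lambda^q$ for all $\lambda>0$. Finally let $$Q_w=\inf\{q>0:\operatorname{wcap}_q(A,B)<\infty\text{ for all open }A,B\subseteq Z\text{ with }\operatorname{dist}(A,B)>0\},$$ and let $\operatorname{ARCdim}(Z,d)$, the Ahlfors regular conformal dimension, be the infimum of the Hausdorff dimensions of $(Z,\theta)$ over all metrics $\theta$ on $Z$ such that $(Z,\theta)$ is Ahlfors regular (of some exponent, for some Borel measure) and the identity $(Z,d)\to(Z,\theta)$ is a quasisymmetry.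 A map $f$ is a quasisymmetry if, for some homeomorphism $\eta$ of $[0,\infty)$, one has $|f(x)-f(y)|\le\eta(t)|f(x)-f(z)|$ whenever $|x-y|\le t|x-z|$. Then there are open balls $A,B\subseteq Z$ with $\operatorname{dist}(A,B)>0$ such that $\operatorname{wcap}_q(A,B)=\infty$ for every hyperbolic filling of $Z$ and every $0<q<Q$. Consequently $Q_w=\operatorname{ARCdim}(Z,d)=Q$ for every hyperbolic filling of $Z$. -/

import Mathlib

open Set Filter Topology MeasureTheory
open scoped ENNReal NNReal

noncomputable section

/-! ### Metric notions -/

/-- The distance `inf {d(a,b) : a ∈ A, b ∈ B}` between two sets (infinite if one of them is empty). -/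
def setDist {Z : Type*} [MetricSpace Z] (A B : Set Z) : ℝ≥0∞ :=
  ⨅ a ∈ A, ⨅ b ∈ B, edist a b

/-- Ahlfors `Q`-regularity: `c r ^ Q ≤ μ (B(z,r)) ≤ C r ^ Q` for all `z` and `0 < r ≤ diam Z`. -/
def IsAhlforsRegular {Z : Type*} [MetricSpace Z] [MeasurableSpace Z]
    (μ : Measure Z) (Q : ℝ) : Prop :=
  ∃ c C : ℝ, 0 < c ∧ 0 < C ∧ ∀ (z : Z) (r : ℝ), 0 < r →
    ENNReal.ofReal r ≤ Metric.ediam (univ : Set Z) →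
      ENNReal.ofReal (c * r ^ Q) ≤ μ (Metric.ball z r) ∧
        μ (Metric.ball z r) ≤ ENNReal.ofReal (C * r ^ Q)

/-- A metric space is Ahlfors regular if it carries a Borel measure that is Ahlfors `Q`-regular
for some `Q > 0`. -/
def IsAhlforsRegularSpace (Z : Type*) [MetricSpace Z] : Prop :=
  ∃ (Q : ℝ) (ν : @Measure Z (borel Z)), 0 < Q ∧ @IsAhlforsRegular Z _ (borel Z) ν Q

/-- `f` is an `η`-quasisymmetry for some homeomorphism `η` of `[0,∞)`. -/
def IsQuasisymmetry {X Y : Type*} [MetricSpace X] [MetricSpace Y] (f : X → Y) : Prop :=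
  ∃ η : ℝ≥0 ≃ₜ ℝ≥0, ∀ (x y z : X) (t : ℝ≥0),
    dist x y ≤ t * dist x z → dist (f x) (f y) ≤ η t * dist (f x) (f z)

/-- The Ahlfors regular conformal dimension: the infimum of the Hausdorff dimensions of `(Z,θ)`
over all Ahlfors regular metrics `θ` on `Z` for which the identity `(Z,d) → (Z,θ)` is a
quasisymmetry. -/
def arConformalDim (Z : Type*) [d : MetricSpace Z] : ℝ≥0∞ :=
  ⨅ (θ : MetricSpace Z) (_ : @IsQuasisymmetry Z Z d θ id) (_ : @IsAhlforsRegularSpace Z θ),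
    @dimH Z θ.toEMetricSpace univ

/-! ### Paths and modulus -/

/-- A path: a continuous map into `Z` from a nonempty interval `dom ⊆ ℝ`, which need be neither
closed nor bounded (the values of `toFun` off `dom` play no role). -/
structure MetricPath (Z : Type*) [MetricSpace Z] where
  dom : Set ℝ
  ordConnected : dom.OrdConnected
  nonempty : dom.Nonempty
  toFun : ℝ → Z
  continuousOn : ContinuousOn toFun dom

namespace MetricPath

variable {Z : Type*} [MetricSpace Z]

/-- The path takes at least two values. -/
def Nonconstant (γ : MetricPath Z) : Prop :=
  ∃ t ∈ γ.dom, ∃ t' ∈ γ.dom, γ.toFun t ≠ γ.toFun t'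

/-- The path has finite length. -/
def Rectifiable (γ : MetricPath Z) : Prop :=
  eVariationOn γ.toFun γ.dom ≠ ∞

/-- The integral of `ρ` along a rectifiable path with respect to its arclength parameterization.
Arclength is measured from an arbitrary base point of `dom`; the choice only translates the
parameter. -/
def lineIntegral (γ : MetricPath Z) (ρ : Z → ℝ≥0∞) : ℝ≥0∞ :=
  ∫⁻ u in variationOnFromTo γ.toFun γ.dom γ.nonempty.some '' γ.dom,
    ρ (naturalParameterization γ.toFun γ.dom γ.nonempty.some u)

end MetricPath

/-- `ρ` is admissible for the path family `Γ`: a Borel function with integral at least `1` along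
every rectifiable path of `Γ`. -/
def IsModulusAdmissible {Z : Type*} [MetricSpace Z] [MeasurableSpace Z]
    (Γ : Set (MetricPath Z)) (ρ : Z → ℝ≥0∞) : Prop :=
  Measurable ρ ∧ ∀ γ ∈ Γ, γ.Rectifiable → 1 ≤ γ.lineIntegral ρ

/-- The `p`-modulus of a path family. -/
def pathModulus {Z : Type*} [MetricSpace Z] [MeasurableSpace Z]
    (μ : Measure Z) (p : ℝ) (Γ : Set (MetricPath Z)) : ℝ≥0∞ :=
  ⨅ (ρ : Z → ℝ≥0∞) (_ : IsModulusAdmissible Γ ρ), ∫⁻ z, ρ z ^ p ∂μ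

/-! ### Hyperbolic fillings and weak capacity -/

/-- The weak `ℓ^p`-norm: the infimum of all `C > 0` such that
`#{x : f x > t} ≤ C ^ p / t ^ p` for all `t > 0`. -/
def weakNorm {ι : Type*} (p : ℝ) (f : ι → ℝ≥0∞) : ℝ≥0∞ :=
  ⨅ (C : ℝ≥0) (_ : 0 < C ∧ ∀ t : ℝ≥0, 0 < t →
    ((Set.encard {x | (t : ℝ≥0∞) < f x} : ℕ∞) : ℝ≥0∞) ≤ (C : ℝ≥0∞) ^ p / (t : ℝ≥0∞) ^ p),
    (C : ℝ≥0∞)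

/-- The points of `P` have mutual distances at least `ε`. -/
def IsSeparatedSet {Z : Type*} [MetricSpace Z] (ε : ℝ) (P : Set Z) : Prop :=
  P.Pairwise fun x y => ε ≤ dist x y

/-- The data of a hyperbolic filling of `Z`: a parameter `s > 1`, a unit of length `R > diam Z`
(measuring distances in multiples of `R` is the rescaling that makes the diameter less than `1`),
and for each level `k` a maximal `R s⁻ᵏ`-separated set `centers k`. -/
structure HyperbolicFilling (Z : Type*) [MetricSpace Z] where
  s : ℝ
  one_lt_s : 1 < s
  R : ℝ
  diam_lt : Metric.ediam (univ : Set Z) < ENNReal.ofReal R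
  centers : ℕ → Set Z
  maximal_centers : ∀ k, Maximal (IsSeparatedSet (R * s⁻¹ ^ k)) (centers k)

namespace HyperbolicFilling

variable {Z : Type*} [MetricSpace Z] (X : HyperbolicFilling Z)

/-- Vertices: the disjoint union over the levels `k` of the sets of centers of level `k`. -/
def Vertex : Type _ := Σ k : ℕ, X.centers k

variable {X}

/-- The level of a vertex. -/
def Vertex.level (v : X.Vertex) : ℕ := v.1

/-- The center of the ball of a vertex. -/
def Vertex.center (v : X.Vertex) : Z := v.2.1

/-- The radius `2 R s⁻ᵏ` of the ball of a vertex of level `k`. -/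
def Vertex.radius (v : X.Vertex) : ℝ := 2 * (X.R * X.s⁻¹ ^ v.level)

/-- The ball of a vertex. -/
def Vertex.ball (v : X.Vertex) : Set Z := Metric.ball v.center v.radius

variable (X)

/-- Distinct vertices are joined by an edge if their levels differ by at most one and the closures
of their balls intersect. -/
def graph : SimpleGraph X.Vertex where
  Adj v w := v ≠ w ∧ v.level ≤ w.level + 1 ∧ w.level ≤ v.level + 1 ∧
    (closure v.ball ∩ closure w.ball).Nonempty
  symm := ⟨fun v w h => ⟨h.1.symm, h.2.2.1, h.2.1, by rw [inter_comm]; exact h.2.2.2⟩⟩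
  loopless := ⟨fun _ h => h.1 rfl⟩

variable {X}

/-- Nontangential convergence of a sequence of vertices to a point of `Z`. -/
def TendstoNontangentially (v : ℕ → X.Vertex) (z : Z) : Prop :=
  Tendsto (fun n => (v n).center) atTop (𝓝 z) ∧
    Tendsto (fun n => (v n).radius) atTop (𝓝 0) ∧
      ∃ C : ℝ, 0 < C ∧ ∀ n, dist z (v n).center ≤ C * (v n).radius

variable (X)

/-- `τ` is admissible for `A` and `B`: every infinite path in the filling, one of whose ends has a
nontangential limit in `A` and the other one in `B`, has `τ`-length at least `1`. -/
def IsAdmissible (A B : Set Z) (τ : X.graph.edgeSet → ℝ≥0∞) : Prop :=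
  ∀ (v : ℤ → X.Vertex) (hv : ∀ k, X.graph.Adj (v k) (v (k + 1))),
    ∀ a ∈ A, ∀ b ∈ B,
      TendstoNontangentially (fun n : ℕ => v (-(n : ℤ))) a →
      TendstoNontangentially (fun n : ℕ => v (n : ℤ)) b →
        1 ≤ ∑' k : ℤ, τ ⟨s(v k, v (k + 1)), hv k⟩

/-- The weak `p`-capacity between `A` and `B`. -/
def wcap (p : ℝ) (A B : Set Z) : ℝ≥0∞ :=
  ⨅ (τ : X.graph.edgeSet → ℝ≥0∞) (_ : X.IsAdmissible A B τ), weakNorm p τ ^ p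

/-- The critical exponent `Q_w`: the infimum of all `p > 0` such that the weak `p`-capacity between
any two open sets at positive distance is finite. -/
def Qw : ℝ≥0∞ :=
  ⨅ (p : ℝ) (_ : 0 < p ∧ ∀ A B : Set Z, IsOpen A → IsOpen B → 0 < setDist A B →
    X.wcap p A B < ∞), ENNReal.ofReal p

end HyperbolicFilling

end

/-!
Let `θ` be an Ahlfors `Q'`-regular metric quasisymmetric to `d`. The function sending an edge to a
multiple of the `θ`-distance of its two centers is admissible for sets at positive distance, by the
triangle inequality, and lies in `ℓ^q` for every `q > Q'`, by a volume count at each level. Hence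
`Q_w ≤ Q'`, in particular `Q_w ≤ Q`.

For the reverse inequality let `τ` be admissible for `A` and `B` and have finite weak `ℓ^q`-norm for
some `q < Q`, so that `τ ∈ ℓ^Q`. By a Borel-Cantelli argument, for `ℋ¹`-almost every `z` the tails
of `τ` along rays of vertices whose balls contain `z` tend to `0`. A path from `A` to `B` meets both
open sets in positive `ℋ¹`-measure, hence in such good points. Join the rays descending to a good
point in `A` and to a good point in `B` by a chain of vertices of level `n` whose balls meet the
path: admissibility shows that `τ` has sum at least `1/2` along the chain when `n` is large.
Consequently the path integral of `ρ_n = ∑ τ(v) r_v⁻¹ 1_{2 B_v}`, summed over the vertices of level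
`n`, is bounded below, whereas `∫ ρ_n ^ Q ≲ ∑ τ(v) ^ Q → 0`. Thus the paths from `A` to `B` have
`Q`-modulus zero. Every nonconstant path contains points of two balls at positive distance taken
from a countable family, so one pair of balls has infinite capacity for all `q < Q`.
-/

/-! ### Sums of nonnegative extended reals and weak `ℓ^q` -/

section Sums

variable {ι κ : Type*}

theorem iSup_rpow_le_tsum_rpow (f : ι → ℝ≥0∞) {p : ℝ} (hp : 0 < p) :
    (⨆ i, f i) ^ p ≤ ∑' i, f i ^ p := by
  rw [← ENNReal.le_rpow_inv_iff hp]
  exact iSup_le fun i => (ENNReal.le_rpow_inv_iff hp).2 (ENNReal.le_tsum i)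

theorem tsum_const_le_of_encard_le {S : Set ι} {N : ℕ} (hS : S.encard ≤ N) (b : ℝ≥0∞) :
    ∑' _ : S, b ≤ N * b := by
  rw [ENNReal.tsum_set_const]
  gcongr
  simpa using ENat.toENNReal_le.2 hS

theorem tsum_comp_le_of_encard_preimage_le {f : ι → κ} {N : ℕ}
    (hf : ∀ k, (f ⁻¹' {k}).encard ≤ N) (g : κ → ℝ≥0∞) :
    ∑' i, g (f i) ≤ N * ∑' k, g k := by
  rw [← ENNReal.tsum_fiberwise _ f, ← ENNReal.tsum_mul_left]
  refine ENNReal.tsum_le_tsum fun k => ?_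
  calc ∑' i : f ⁻¹' {k}, g (f i) = ∑' _ : f ⁻¹' {k}, g k := tsum_congr fun i => by rw [i.2]
    _ ≤ N * g k := tsum_const_le_of_encard_le (hf k) _

theorem weakNorm_lt_top_of_tsum_rpow_ne_top {q : ℝ} (hq : 0 < q) {f : ι → ℝ≥0∞}
    (hf : ∑' i, f i ^ q ≠ ∞) : weakNorm q f < ∞ := by
  have hC : (∑' i, f i ^ q) ^ q⁻¹ ≠ ∞ := ENNReal.rpow_ne_top_of_nonneg (inv_pos.2 hq).le hf
  refine (iInf₂_le (((∑' i, f i ^ q) ^ q⁻¹).toNNReal + 1)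
    ⟨by positivity, fun t ht => ?_⟩).trans_lt ENNReal.coe_lt_top
  rw [ENNReal.le_div_iff_mul_le (.inl (by simp [ENNReal.rpow_eq_zero_iff, ht.ne', hq.not_gt]))
    (.inl (ENNReal.rpow_ne_top_of_nonneg hq.le ENNReal.coe_ne_top)), ← ENNReal.tsum_set_const]
  calc ∑' _ : {i | (t : ℝ≥0∞) < f i}, (t : ℝ≥0∞) ^ q
      ≤ ∑' i : {i | (t : ℝ≥0∞) < f i}, f i ^ q :=
        ENNReal.tsum_le_tsum fun i => ENNReal.rpow_le_rpow i.2.le hq.le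
    _ ≤ ∑' i, f i ^ q := ENNReal.tsum_comp_le_tsum_of_injective Subtype.val_injective _
    _ = ((∑' i, f i ^ q) ^ q⁻¹) ^ q := by
      rw [← ENNReal.rpow_mul, inv_mul_cancel₀ hq.ne', ENNReal.rpow_one]
    _ ≤ _ := by
      rw [ENNReal.coe_add, ENNReal.coe_toNNReal hC]
      exact ENNReal.rpow_le_rpow le_self_add hq.le

theorem exists_encard_lt_le_of_weakNorm_ne_top {q : ℝ} {f : ι → ℝ≥0∞} (hf : weakNorm q f ≠ ∞) :
    ∃ C : ℝ, 0 < C ∧ ∀ t : ℝ, 0 < t →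
      ({i | ENNReal.ofReal t < f i}.encard : ℝ≥0∞) ≤ ENNReal.ofReal ((C / t) ^ q) := by
  obtain ⟨C, hC⟩ := iInf_lt_iff.1 hf.lt_top
  obtain ⟨⟨hC0, hCf⟩, -⟩ := iInf_lt_iff.1 hC
  refine ⟨C, hC0, fun t ht => (hCf t.toNNReal (Real.toNNReal_pos.2 ht)).trans_eq ?_⟩
  have hC0' : (0 : ℝ) < C := hC0
  rw [Real.div_rpow hC0'.le ht.le, ENNReal.ofReal_div_of_pos (Real.rpow_pos_of_pos ht _),
    ← ENNReal.ofReal_rpow_of_pos ht, ← ENNReal.ofReal_rpow_of_pos hC0', ENNReal.ofReal_coe_nnreal,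
    ENNReal.ofReal]

theorem exists_forall_le_of_weakNorm_ne_top {q : ℝ} (hq : 0 < q) {f : ι → ℝ≥0∞}
    (hf : weakNorm q f ≠ ∞) : ∃ C : ℝ, ∀ i, f i ≤ ENNReal.ofReal C := by
  obtain ⟨C, hC, hfC⟩ := exists_encard_lt_le_of_weakNorm_ne_top hf
  refine ⟨2 * C, fun i => ?_⟩
  by_contra! hlt
  have hone : 1 ≤ {i | ENNReal.ofReal (2 * C) < f i}.encard :=
    one_le_encard_iff_nonempty.2 ⟨i, hlt⟩
  refine ((ENat.toENNReal_le.2 hone).trans (hfC (2 * C) (by positivity))).not_gt ?_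
  rw [ENat.toENNReal_one, ENNReal.ofReal_lt_one]
  exact Real.rpow_lt_one (by positivity) ((div_lt_one (by positivity)).2 (by linarith)) hq

theorem tsum_rpow_eq_lintegral_encard_lt {r : ℝ} (hr : 0 < r) {f : ι → ℝ≥0∞}
    (hf : ∀ i, f i ≠ ∞) :
    ∑' i, f i ^ r = ENNReal.ofReal r * ∫⁻ t in Ioi (0 : ℝ),
      {i | ENNReal.ofReal t < f i}.encard * ENNReal.ofReal (t ^ (r - 1)) := by
  let _ : MeasurableSpace ι := ⊤
  have hlayer := lintegral_rpow_eq_lintegral_meas_lt_mul (μ := .count)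
    (.of_forall fun i => ENNReal.toReal_nonneg (a := f i)) Measurable.of_discrete.aemeasurable hr
  simp_rw [← ENNReal.ofReal_rpow_of_nonneg ENNReal.toReal_nonneg hr.le,
    ENNReal.ofReal_toReal (hf _), lintegral_count,
    Measure.count_apply (MeasurableSpace.measurableSet_top)] at hlayer
  rw [hlayer]
  congr 1
  refine setLIntegral_congr_fun measurableSet_Ioi fun t ht => ?_
  simp_rw [ENNReal.ofReal_lt_iff_lt_toReal (mem_Ioi.1 ht).le (hf _)]

theorem tsum_rpow_ne_top_of_weakNorm_ne_top {q r : ℝ} (hq : 0 < q) (hqr : q < r)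
    {f : ι → ℝ≥0∞} (hf : weakNorm q f ≠ ∞) : ∑' i, f i ^ r ≠ ∞ := by
  obtain ⟨C, hC, hfC⟩ := exists_encard_lt_le_of_weakNorm_ne_top hf
  obtain ⟨T, hT⟩ := exists_forall_le_of_weakNorm_ne_top hq hf
  have hint : IntegrableOn (fun t : ℝ => C ^ q * t ^ (r - q - 1)) (Ioc 0 T) := by
    rcases le_or_gt T 0 with hT0 | hT0
    · simp [Ioc_eq_empty hT0.not_gt]
    · exact (intervalIntegrable_iff_integrableOn_Ioc_of_le hT0.le).1
        ((intervalIntegral.intervalIntegrable_rpow' (by linarith)).const_mul _)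
  rw [tsum_rpow_eq_lintegral_encard_lt (hq.trans hqr)
    fun i => ne_top_of_le_ne_top ENNReal.ofReal_ne_top (hT i)]
  refine ENNReal.mul_ne_top ENNReal.ofReal_ne_top
    (ne_top_of_le_ne_top hint.lintegral_lt_top.ne ?_)
  rw [← lintegral_indicator measurableSet_Ioc, ← lintegral_indicator measurableSet_Ioi]
  refine lintegral_mono fun t => ?_
  rcases le_or_gt t 0 with ht | ht
  · simp [indicator_of_notMem (notMem_Ioi.2 ht)]
  rw [indicator_of_mem (mem_Ioi.2 ht)]
  rcases lt_or_ge T t with hTt | hTt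
  · have hempty : {i | ENNReal.ofReal t < f i} = ∅ := eq_empty_of_forall_notMem fun i hi =>
      ((hT i).trans (ENNReal.ofReal_le_ofReal hTt.le)).not_gt hi
    simp [hempty]
  · rw [indicator_of_mem (mem_Ioc.2 ⟨ht, hTt⟩)]
    calc _ ≤ ENNReal.ofReal ((C / t) ^ q) * ENNReal.ofReal (t ^ (r - 1)) := by
          gcongr
          exact hfC t ht
      _ = ENNReal.ofReal (C ^ q * t ^ (r - q - 1)) := by
          rw [← ENNReal.ofReal_mul (by positivity), Real.div_rpow hC.le ht.le,
            show r - q - 1 = r - 1 - q by ring, Real.rpow_sub ht (r - 1) q]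
          ring_nf

end Sums

/-! ### Hausdorff measures -/

section Hausdorff

variable {Y : Type*} [EMetricSpace Y] [MeasurableSpace Y] [BorelSpace Y]

theorem hausdorffMeasure_setOf_frequently_mem_eq_zero {ι : Type*} [Countable ι] {d : ℝ}
    (hd : 0 < d) (U : ι → Set Y) (hU : ∑' i, Metric.ediam (U i) ^ d ≠ ∞) :
    μH[d] {z | ∃ᶠ i in cofinite, z ∈ U i} = 0 := by
  have htail := ENNReal.tendsto_tsum_compl_atTop_zero hU
  have hmesh := (ENNReal.continuous_rpow_const (y := d⁻¹)).tendsto' 0 0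
    (ENNReal.zero_rpow_of_pos (inv_pos.2 hd)) |>.comp htail
  refine le_antisymm ((Measure.hausdorffMeasure_le_liminf_tsum d _ _ hmesh
    (fun (F : Finset ι) (i : {i // i ∉ F}) => U i) (.of_forall fun F i => ?_)
    (.of_forall fun F z hz => ?_)).trans_eq htail.liminf_eq) zero_le
  · exact (ENNReal.le_rpow_inv_iff hd).2 (ENNReal.le_tsum (f := fun j : {i // i ∉ F} => _) i)
  · obtain ⟨i, hi, hiF⟩ := (frequently_cofinite_iff_infinite.1 hz).exists_notMem_finset F
    exact mem_iUnion.2 ⟨⟨i, hiF⟩, hi⟩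

end Hausdorff

section HausdorffOne

variable {Z : Type*} [MetricSpace Z] [MeasurableSpace Z] [BorelSpace Z]

theorem ofReal_sub_le_hausdorffMeasure_one_inter_ball {S : Set Z} (hS : IsPreconnected S)
    {x y z : Z} {a b : ℝ} (hy : y ∈ S) (hya : dist x y ≤ a) (hz : z ∈ S) (hzb : b ≤ dist x z) :
    ENNReal.ofReal (b - a) ≤ μH[1] (S ∩ Metric.ball x b) := by
  have himage : Ico a b ⊆ dist x '' (S ∩ Metric.ball x b) := fun r hr => by
    obtain ⟨w, hwS, rfl⟩ := hS.intermediate_value hy hz (f := dist x) (by fun_prop)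
      ⟨hya.trans hr.1, hr.2.le.trans hzb⟩
    exact ⟨w, ⟨hwS, Metric.mem_ball'.2 hr.2⟩, rfl⟩
  calc ENNReal.ofReal (b - a) = volume (Ico a b) := Real.volume_Ico.symm
    _ ≤ μH[1] (dist x '' (S ∩ Metric.ball x b)) := by
      rw [← hausdorffMeasure_real]
      exact measure_mono himage
    _ ≤ μH[1] (S ∩ Metric.ball x b) := by
      simpa using (LipschitzWith.dist_right x).hausdorffMeasure_image_le zero_le_one _

theorem hausdorffMeasure_one_inter_pos_of_isPreconnected {S U : Set Z} (hS : IsPreconnected S)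
    (hS' : S.Nontrivial) (hU : IsOpen U) (hSU : (S ∩ U).Nonempty) : 0 < μH[1] (S ∩ U) := by
  obtain ⟨z, hzS, hzU⟩ := hSU
  obtain ⟨w, hwS, hwz⟩ := hS'.exists_ne z
  obtain ⟨ε, hε, hεU⟩ := Metric.isOpen_iff.1 hU z hzU
  have hpos : 0 < min ε (dist z w) := lt_min hε (dist_pos.2 hwz.symm)
  calc 0 < ENNReal.ofReal (min ε (dist z w) - 0) := by rwa [sub_zero, ENNReal.ofReal_pos]
    _ ≤ μH[1] (S ∩ Metric.ball z (min ε (dist z w))) :=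
      ofReal_sub_le_hausdorffMeasure_one_inter_ball hS hzS (dist_self z).le hwS (min_le_right _ _)
    _ ≤ μH[1] (S ∩ U) := by
      gcongr
      exact (Metric.ball_subset_ball (min_le_left _ _)).trans hεU

theorem one_le_dimH_univ_of_isPreconnected {S : Set Z} (hS : IsPreconnected S)
    (hS' : S.Nontrivial) : 1 ≤ dimH (univ : Set Z) := by
  have hpos := hausdorffMeasure_one_inter_pos_of_isPreconnected hS hS' isOpen_univ
    (by simpa using hS'.nonempty)
  rw [inter_univ] at hpos
  exact_mod_cast (le_dimH_of_hausdorffMeasure_ne_zero (d := 1) (by simpa using hpos.ne')).trans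
    (dimH_mono (subset_univ S))

end HausdorffOne

/-! ### Separated sets -/

section SeparatedSets

variable {Z : Type*} [MetricSpace Z] {ε : ℝ} {P : Set Z}

theorem exists_maximal_isSeparatedSet (Z : Type*) [MetricSpace Z] (ε : ℝ) :
    ∃ P : Set Z, Maximal (IsSeparatedSet ε) P := by
  refine zorn_subset {P : Set Z | IsSeparatedSet ε P} fun c hc hchain => ?_
  refine ⟨⋃₀ c, ?_, fun s hs => subset_sUnion_of_mem hs⟩
  rintro x ⟨s, hs, hxs⟩ y ⟨t, ht, hyt⟩ hxy
  rcases hchain.total hs ht with h | h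
  · exact hc ht (h hxs) hyt hxy
  · exact hc hs hxs (h hyt) hxy

theorem exists_dist_lt_of_maximal_isSeparatedSet (hε : 0 < ε)
    (hP : Maximal (IsSeparatedSet ε) P) (z : Z) : ∃ x ∈ P, dist z x < ε := by
  by_contra! hfar
  have hz : z ∉ P := fun hz => hε.not_ge (by simpa using hfar z hz)
  refine hz (hP.le_of_ge (y := insert z P) ?_ (subset_insert _ _) (mem_insert _ _))
  exact hP.prop.insert fun y hy _ => ⟨hfar y hy, dist_comm y z ▸ hfar y hy⟩

theorem IsSeparatedSet.tsum_measure_ball_le [MeasurableSpace Z] [OpensMeasurableSpace Z]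
    (hP : IsSeparatedSet ε P) (μ : Measure Z) :
    ∑' x : P, μ (Metric.ball x (ε / 2)) ≤ μ (Metric.thickening (ε / 2) P) := by
  refine (tsum_meas_le_meas_iUnion_of_disjoint μ (fun x => Metric.isOpen_ball.measurableSet)
    fun x y hxy => Metric.ball_disjoint_ball ?_).trans_eq ?_
  · rw [add_halves]
    exact hP x.2 y.2 (Subtype.coe_ne_coe.2 hxy)
  · rw [Metric.thickening_eq_biUnion_ball, biUnion_eq_iUnion]

end SeparatedSets

/-! ### Ahlfors regular measures -/

theorem exists_ofReal_le_ediam_univ (Z : Type*) [MetricSpace Z] [Nontrivial Z] {R : ℝ}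
    (hR : 0 < R) :
    ∃ D : ℝ, 0 < D ∧ D ≤ R ∧ ENNReal.ofReal D ≤ Metric.ediam (univ : Set Z) := by
  obtain ⟨x, y, hxy⟩ := exists_pair_ne Z
  refine ⟨min (dist x y) R, lt_min (dist_pos.2 hxy) hR, min_le_right _ _, ?_⟩
  calc ENNReal.ofReal (min (dist x y) R) ≤ ENNReal.ofReal (dist x y) :=
        ENNReal.ofReal_le_ofReal (min_le_left _ _)
    _ = edist x y := (edist_dist x y).symm
    _ ≤ _ := Metric.edist_le_ediam_of_mem (mem_univ x) (mem_univ y)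

namespace IsAhlforsRegular

variable {Z : Type*} [MetricSpace Z] [Nontrivial Z] [MeasurableSpace Z] {μ : Measure Z} {Q : ℝ}

theorem exists_le_measure_ball (hμ : IsAhlforsRegular μ Q) {R : ℝ} (hR : 0 < R) :
    ∃ c : ℝ, 0 < c ∧ ∀ (z : Z) (r : ℝ), 0 < r → r ≤ R →
      ENNReal.ofReal (c * r ^ Q) ≤ μ (Metric.ball z r) := by
  obtain ⟨c, _, hc, -, hball⟩ := hμ
  obtain ⟨D, hD, hDR, hDZ⟩ := exists_ofReal_le_ediam_univ Z hR
  refine ⟨c * (D / R) ^ Q, by positivity, fun z r hr hrR => ?_⟩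
  have hscale : ENNReal.ofReal (D / R * r) ≤ Metric.ediam (univ : Set Z) := by
    refine (ENNReal.ofReal_le_ofReal ?_).trans hDZ
    rw [div_mul_eq_mul_div, div_le_iff₀ hR]
    gcongr
  calc ENNReal.ofReal (c * (D / R) ^ Q * r ^ Q) = ENNReal.ofReal (c * (D / R * r) ^ Q) := by
        rw [Real.mul_rpow (by positivity) hr.le, mul_assoc]
    _ ≤ μ (Metric.ball z (D / R * r)) := (hball z _ (by positivity) hscale).1
    _ ≤ μ (Metric.ball z r) := measure_mono
        (Metric.ball_subset_ball (mul_le_of_le_one_left hr.le ((div_le_one hR).2 hDR)))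

theorem measure_univ_ne_zero (hμ : IsAhlforsRegular μ Q) : μ univ ≠ 0 := by
  obtain ⟨c, hc, hball⟩ := hμ.exists_le_measure_ball one_pos
  have hpos : 0 < ENNReal.ofReal (c * 1 ^ Q) := ENNReal.ofReal_pos.2 (by simpa using hc)
  exact (hpos.trans_le ((hball (Classical.arbitrary Z) 1 one_pos le_rfl).trans
    (measure_mono (subset_univ _)))).ne'

theorem isFiniteMeasure (hμ : IsAhlforsRegular μ Q) (hZ : TotallyBounded (univ : Set Z)) :
    IsFiniteMeasure μ := by
  obtain ⟨_, C, -, -, hball⟩ := hμ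
  obtain ⟨D, hD, -, hDZ⟩ := exists_ofReal_le_ediam_univ Z one_pos
  obtain ⟨t, ht, hcover⟩ := Metric.totallyBounded_iff.1 hZ D hD
  exact ⟨(measure_mono hcover).trans_lt (measure_biUnion_lt_top ht fun y _ =>
    (hball y D hD hDZ).2.trans_lt ENNReal.ofReal_lt_top)⟩

variable [IsFiniteMeasure μ]

theorem exists_measure_ball_le (hQ : 0 < Q) (hμ : IsAhlforsRegular μ Q) :
    ∃ C : ℝ, 0 < C ∧ ∀ (z : Z) (r : ℝ), 0 < r →
      μ (Metric.ball z r) ≤ ENNReal.ofReal (C * r ^ Q) := by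
  obtain ⟨_, C, -, hC, hball⟩ := hμ
  obtain ⟨D, hD, -, hDZ⟩ := exists_ofReal_le_ediam_univ Z one_pos
  refine ⟨max C (μ.real univ / D ^ Q), lt_max_of_lt_left hC, fun z r hr => ?_⟩
  rcases le_or_gt (ENNReal.ofReal r) (Metric.ediam (univ : Set Z)) with hrZ | hrZ
  · refine (hball z r hr hrZ).2.trans (ENNReal.ofReal_le_ofReal ?_)
    gcongr
    exact le_max_left _ _
  · have hDr : D ≤ r := ((ENNReal.ofReal_le_ofReal_iff hr.le).1 (hDZ.trans hrZ.le))
    rw [← ofReal_measureReal]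
    refine ENNReal.ofReal_le_ofReal ?_
    calc μ.real (Metric.ball z r) ≤ μ.real univ := measureReal_mono (subset_univ _)
      _ = μ.real univ / D ^ Q * D ^ Q := by field_simp
      _ ≤ max C (μ.real univ / D ^ Q) * r ^ Q := by
        gcongr
        exact le_max_right _ _

variable [OpensMeasurableSpace Z]

theorem exists_encard_inter_ball_le (hQ : 0 < Q) (hμ : IsAhlforsRegular μ Q) {R K : ℝ}
    (hR : 0 < R) (hK : 0 < K) :
    ∃ M : ℕ, ∀ ε : ℝ, 0 < ε → ε ≤ R → ∀ P : Set Z, IsSeparatedSet ε P → ∀ z : Z,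
      (P ∩ Metric.ball z (K * ε)).encard ≤ M := by
  obtain ⟨C, hC, hupper⟩ := hμ.exists_measure_ball_le hQ
  obtain ⟨c, hc, hlower⟩ := hμ.exists_le_measure_ball hR
  refine ⟨⌈C / c * (2 * (K + 1)) ^ Q⌉₊, fun ε hε hεR P hP z => ?_⟩
  set S := P ∩ Metric.ball z (K * ε)
  have hthick : Metric.thickening (ε / 2) S ⊆ Metric.ball z ((K + 1) * ε) :=
    fun y hy => by
      obtain ⟨x, hxS, hyx⟩ := Metric.mem_thickening_iff.1 hy
      have hxz := Metric.mem_ball.1 hxS.2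
      exact Metric.mem_ball.2 (by linarith [dist_triangle y x z])
  have hmass : S.encard * ENNReal.ofReal (c * (ε / 2) ^ Q) ≤
      ENNReal.ofReal (C * ((K + 1) * ε) ^ Q) := by
    calc S.encard * ENNReal.ofReal (c * (ε / 2) ^ Q)
        = ∑' _ : S, ENNReal.ofReal (c * (ε / 2) ^ Q) := (ENNReal.tsum_set_const _ _).symm
      _ ≤ ∑' x : S, μ (Metric.ball x (ε / 2)) :=
        ENNReal.tsum_le_tsum fun x => hlower _ _ (by positivity) (by linarith)
      _ ≤ μ (Metric.thickening (ε / 2) S) :=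
        IsSeparatedSet.tsum_measure_ball_le (hP.mono inter_subset_left) μ
      _ ≤ ENNReal.ofReal (C * ((K + 1) * ε) ^ Q) :=
        (measure_mono hthick).trans (hupper z _ (by positivity))
  have hratio : C * ((K + 1) * ε) ^ Q = C / c * (2 * (K + 1)) ^ Q * (c * (ε / 2) ^ Q) := by
    rw [show (K + 1) * ε = 2 * (K + 1) * (ε / 2) by ring,
      Real.mul_rpow (by positivity) (by positivity)]
    field_simp
  rw [hratio, ENNReal.ofReal_mul (p := C / c * (2 * (K + 1)) ^ Q) (by positivity),
    ENNReal.mul_le_mul_iff_left (ENNReal.ofReal_pos.2 (by positivity)).ne'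
      ENNReal.ofReal_ne_top] at hmass
  have hceil : ENNReal.ofReal (C / c * (2 * (K + 1)) ^ Q) ≤ ⌈C / c * (2 * (K + 1)) ^ Q⌉₊ :=
    ENNReal.ofReal_le_of_le_toReal (by simpa using Nat.le_ceil _)
  exact ENat.toENNReal_le.1 (by simpa using hmass.trans hceil)

theorem finite_of_isSeparatedSet (hμ : IsAhlforsRegular μ Q) {ε : ℝ} (hε : 0 < ε) {P : Set Z}
    (hP : IsSeparatedSet ε P) : P.Finite := by
  obtain ⟨c, hc, hball⟩ := hμ.exists_le_measure_ball (half_pos hε)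
  have hmass : P.encard * ENNReal.ofReal (c * (ε / 2) ^ Q) ≤ μ univ := by
    rw [← ENNReal.tsum_set_const]
    exact (ENNReal.tsum_le_tsum fun x : P => hball x _ (half_pos hε) le_rfl).trans
      ((hP.tsum_measure_ball_le μ).trans (measure_mono (subset_univ _)))
  refine encard_ne_top_iff.1 fun htop => measure_ne_top μ univ (top_unique ?_)
  rwa [htop, ENat.toENNReal_top,
    ENNReal.top_mul (ENNReal.ofReal_pos.2 (by positivity)).ne'] at hmass

theorem totallyBounded_univ (hμ : IsAhlforsRegular μ Q) : TotallyBounded (univ : Set Z) := by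
  refine Metric.totallyBounded_iff.2 fun ε hε => ?_
  obtain ⟨P, hP⟩ := exists_maximal_isSeparatedSet Z ε
  refine ⟨P, hμ.finite_of_isSeparatedSet hε hP.prop, fun z _ => ?_⟩
  obtain ⟨x, hx, hzx⟩ := exists_dist_lt_of_maximal_isSeparatedSet hε hP z
  exact mem_biUnion hx hzx

end IsAhlforsRegular

/-! ### The Hausdorff dimension of an Ahlfors regular space -/

section Dimension

variable {Z : Type*} [MetricSpace Z]

theorem ediam_ball_le_ofReal (x : Z) (r : ℝ) :
    Metric.ediam (Metric.ball x r) ≤ ENNReal.ofReal (2 * r) :=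
  Metric.ediam_le_of_forall_dist_le fun y hy z hz => by
    linarith [dist_triangle_right y z x, Metric.mem_ball.1 hy, Metric.mem_ball.1 hz]

variable [MeasurableSpace Z] {μ : Measure Z} {Q : ℝ}

theorem measure_le_mul_ediam_rpow {C : ℝ} (hC : 0 < C) (hQ : 0 < Q)
    (hball : ∀ (z : Z) (r : ℝ), 0 < r → μ (Metric.ball z r) ≤ ENNReal.ofReal (C * r ^ Q))
    (s : Set Z) : μ s ≤ ENNReal.ofReal C * Metric.ediam s ^ Q := by
  rcases s.eq_empty_or_nonempty with rfl | ⟨x, hx⟩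
  · simp
  rcases eq_or_ne (Metric.ediam s) ∞ with htop | htop
  · simp [htop, ENNReal.top_rpow_of_pos hQ, ENNReal.mul_top, hC]
  have hlim : Tendsto (fun r : ℝ => ENNReal.ofReal (C * r ^ Q)) (𝓝[>] Metric.diam s)
      (𝓝 (ENNReal.ofReal (C * Metric.diam s ^ Q))) :=
    (ENNReal.tendsto_ofReal ((Real.continuousAt_rpow_const _ _ (.inr hQ.le)).tendsto.const_mul
      C)).mono_left nhdsWithin_le_nhds
  rw [← ENNReal.ofReal_toReal htop, ENNReal.ofReal_rpow_of_nonneg ENNReal.toReal_nonneg hQ.le,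
    ← ENNReal.ofReal_mul hC.le]
  refine ge_of_tendsto hlim (eventually_nhdsWithin_of_forall fun r hr => ?_)
  refine (measure_mono fun y hy => ?_).trans (hball x r (Metric.diam_nonneg.trans_lt hr))
  exact (Metric.dist_le_diam_of_mem' htop hy hx).trans_lt hr

theorem IsSeparatedSet.tsum_ediam_ball_rpow_le [OpensMeasurableSpace Z] (hQ : 0 < Q) {c R : ℝ}
    (hc : 0 < c) (hball : ∀ (z : Z) (r : ℝ), 0 < r → r ≤ R →
      ENNReal.ofReal (c * r ^ Q) ≤ μ (Metric.ball z r))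
    {ε : ℝ} (hε : 0 < ε) (hεR : ε ≤ R) {P : Set Z} (hP : IsSeparatedSet ε P) :
    ∑' x : P, Metric.ediam (Metric.ball (x : Z) ε) ^ Q ≤ ENNReal.ofReal (4 ^ Q / c) * μ univ := by
  have hterm : ∀ x : Z, Metric.ediam (Metric.ball x ε) ^ Q ≤
      ENNReal.ofReal (4 ^ Q / c) * μ (Metric.ball x (ε / 2)) := fun x => by
    calc Metric.ediam (Metric.ball x ε) ^ Q ≤ ENNReal.ofReal (2 * ε) ^ Q := by
          gcongr
          exact ediam_ball_le_ofReal x ε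
      _ = ENNReal.ofReal (4 ^ Q / c) * ENNReal.ofReal (c * (ε / 2) ^ Q) := by
          rw [ENNReal.ofReal_rpow_of_nonneg (by positivity) hQ.le,
            ← ENNReal.ofReal_mul (by positivity), show 2 * ε = 4 * (ε / 2) by ring,
            Real.mul_rpow (by positivity) (by positivity)]
          field_simp
      _ ≤ _ := by
          gcongr
          exact hball x _ (by positivity) (by linarith)
  calc ∑' x : P, Metric.ediam (Metric.ball (x : Z) ε) ^ Q
      ≤ ENNReal.ofReal (4 ^ Q / c) * ∑' x : P, μ (Metric.ball (x : Z) (ε / 2)) := by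
        rw [← ENNReal.tsum_mul_left]
        exact ENNReal.tsum_le_tsum fun x => hterm x
    _ ≤ ENNReal.ofReal (4 ^ Q / c) * μ univ := by
        gcongr
        exact (hP.tsum_measure_ball_le μ).trans (measure_mono (subset_univ _))

variable [Nontrivial Z] [BorelSpace Z] [IsFiniteMeasure μ]

theorem IsAhlforsRegular.le_dimH (hQ : 0 < Q) (hμ : IsAhlforsRegular μ Q) :
    ENNReal.ofReal Q ≤ dimH (univ : Set Z) := by
  obtain ⟨C, hC, hball⟩ := hμ.exists_measure_ball_le hQ
  have hle : (ENNReal.ofReal C)⁻¹ • μ ≤ μH[Q] := by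
    refine Measure.le_hausdorffMeasure Q _ 1 one_pos fun s _ => ?_
    rw [Measure.smul_apply, smul_eq_mul, mul_comm, ← div_eq_mul_inv]
    exact ENNReal.div_le_of_le_mul' (measure_le_mul_ediam_rpow hC hQ hball s)
  refine le_dimH_of_hausdorffMeasure_ne_zero (d := Q.toNNReal) ?_
  rw [Real.coe_toNNReal _ hQ.le]
  refine (lt_of_lt_of_le ?_ (hle univ)).ne'
  exact ENNReal.mul_pos (ENNReal.inv_ne_zero.2 ENNReal.ofReal_ne_top) hμ.measure_univ_ne_zero

theorem IsAhlforsRegular.dimH_le (hQ : 0 < Q) (hμ : IsAhlforsRegular μ Q) :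
    dimH (univ : Set Z) ≤ ENNReal.ofReal Q := by
  obtain ⟨c, hc, hball⟩ := hμ.exists_le_measure_ball one_pos
  have hε : ∀ k : ℕ, 0 < (2⁻¹ : ℝ) ^ k := fun k => by positivity
  have hε1 : ∀ k : ℕ, (2⁻¹ : ℝ) ^ k ≤ 1 := fun k => pow_le_one₀ (by norm_num) (by norm_num)
  choose P hP using fun k : ℕ => exists_maximal_isSeparatedSet Z (2⁻¹ ^ k)
  have : ∀ k, Countable (P k) := fun k =>
    (hμ.finite_of_isSeparatedSet (hε k) (hP k).prop).countable.to_subtype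
  have hmesh : Tendsto (fun k : ℕ => ENNReal.ofReal (2 * 2⁻¹ ^ k)) atTop (𝓝 0) := by
    simpa using ENNReal.tendsto_ofReal
      ((tendsto_pow_atTop_nhds_zero_of_lt_one (r := (2⁻¹ : ℝ)) (by norm_num)
        (by norm_num)).const_mul 2)
  have hcover := Measure.hausdorffMeasure_le_liminf_tsum Q (univ : Set Z) _ hmesh
    (fun k (x : P k) => Metric.ball (x : Z) (2⁻¹ ^ k))
    (.of_forall fun k x => ediam_ball_le_ofReal _ _)
    (.of_forall fun k z _ => by
      obtain ⟨x, hx, hzx⟩ := exists_dist_lt_of_maximal_isSeparatedSet (hε k) (hP k) z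
      exact mem_iUnion.2 ⟨⟨x, hx⟩, hzx⟩)
  refine dimH_le_of_hausdorffMeasure_ne_top (d := Q.toNNReal) ?_
  rw [Real.coe_toNNReal _ hQ.le]
  refine ne_top_of_le_ne_top
    (ENNReal.mul_ne_top (ENNReal.ofReal_ne_top (r := 4 ^ Q / c)) (measure_ne_top μ univ))
    (hcover.trans ((liminf_le_liminf (.of_forall fun k =>
      (hP k).prop.tsum_ediam_ball_rpow_le hQ hc hball (hε k) (hε1 k))).trans (by simp)))

end Dimension

/-! ### Uniformly perfect spaces and quasisymmetries -/

/-- Uniform perfectness: each ball whose radius does not exceed the diameter of the space contains a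
point whose distance to the center is comparable to the radius. It lets a quasisymmetry propagate
the contraction at one scale to all smaller scales. -/
def IsUniformlyPerfect (Z : Type*) [MetricSpace Z] : Prop :=
  ∃ c : ℝ, 0 < c ∧ ∀ (x : Z) (r : ℝ), 0 < r → ENNReal.ofReal r ≤ Metric.ediam (univ : Set Z) →
    ∃ y, c * r ≤ dist x y ∧ dist x y < r

theorem IsAhlforsRegular.isUniformlyPerfect {Z : Type*} [MetricSpace Z] [MeasurableSpace Z]
    {μ : Measure Z} {Q : ℝ} (hQ : 0 < Q) (hμ : IsAhlforsRegular μ Q) : IsUniformlyPerfect Z := by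
  obtain ⟨c, C, hc, hC, hball⟩ := hμ
  set κ : ℝ := min 1 ((c / (2 * C)) ^ Q⁻¹)
  have hκ : 0 < κ := by positivity
  have hκQ : C * κ ^ Q < c := by
    calc C * κ ^ Q ≤ C * ((c / (2 * C)) ^ Q⁻¹) ^ Q := by
          gcongr
          exact min_le_right _ _
      _ = c / 2 := by
          rw [Real.rpow_inv_rpow (by positivity) hQ.ne']
          field_simp
      _ < c := half_lt_self hc
  refine ⟨κ, hκ, fun x r hr hrZ => ?_⟩
  by_contra! hgap
  have hsub : Metric.ball x r ⊆ Metric.ball x (κ * r) := fun y hy => by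
    rw [Metric.mem_ball'] at hy ⊢
    exact lt_of_not_ge fun hle => (hgap y hle).not_gt hy
  have hκr : ENNReal.ofReal (κ * r) ≤ Metric.ediam (univ : Set Z) :=
    (ENNReal.ofReal_le_ofReal (mul_le_of_le_one_left hr.le (min_le_left _ _))).trans hrZ
  have hmass : ENNReal.ofReal (c * r ^ Q) ≤ ENNReal.ofReal (C * (κ * r) ^ Q) :=
    (hball x r hr hrZ).1.trans
      ((measure_mono hsub).trans (hball x (κ * r) (by positivity) hκr).2)
  rw [ENNReal.ofReal_le_ofReal_iff (by positivity), Real.mul_rpow hκ.le hr.le, ← mul_assoc] at hmass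
  exact (le_of_mul_le_mul_right hmass (by positivity)).not_gt hκQ

theorem exists_holderWith_of_forall_pow {Z Y : Type*} [MetricSpace Z] [MetricSpace Y] {f : Z → Y}
    {θ B D : ℝ} (hθ : 0 < θ) (hθ1 : θ < 1) (hD : 0 < D) (hB : ∀ x y, dist (f x) (f y) ≤ B)
    (hf : ∀ (k : ℕ) (x y : Z), dist x y ≤ θ ^ k * D → dist (f x) (f y) ≤ (1 / 2) ^ k * B) :
    ∃ C α : ℝ≥0, 0 < α ∧ HolderWith C α f := by
  set α : ℝ := Real.log (1 / 2) / Real.log θ with hα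
  have hlog : Real.log θ < 0 := Real.log_neg hθ hθ1
  have hα0 : 0 < α := div_pos_of_neg_of_neg (Real.log_neg (by norm_num) (by norm_num)) hlog
  have hθα : θ ^ α = 1 / 2 := by
    rw [Real.rpow_def_of_pos hθ, hα, mul_div_cancel₀ _ hlog.ne, Real.exp_log (by norm_num)]
  have hdist : ∀ x y, dist (f x) (f y) ≤ 2 * B * (dist x y / D) ^ α := fun x y => by
    have hB0 : 0 ≤ B := dist_nonneg.trans (hB x y)
    rcases eq_or_ne x y with rfl | hxy
    · rw [dist_self]
      positivity
    rcases le_or_gt (dist x y / D) 1 with hle | hgt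
    · obtain ⟨n, hn, hn'⟩ :=
        exists_nat_pow_near_of_lt_one (div_pos (dist_pos.2 hxy) hD) hle hθ hθ1
      calc dist (f x) (f y) ≤ (1 / 2) ^ n * B := hf n x y ((div_le_iff₀ hD).1 hn')
        _ = 2 * B * (θ ^ (n + 1)) ^ α := by
          rw [← Real.rpow_pow_comm hθ.le, hθα, pow_succ]
          ring
        _ ≤ 2 * B * (dist x y / D) ^ α := by gcongr
    · nlinarith [hB x y, Real.one_le_rpow hgt.le hα0.le]
  refine ⟨(2 * B / D ^ α).toNNReal, α.toNNReal, Real.toNNReal_pos.2 hα0, fun x y => ?_⟩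
  have hB0 : 0 ≤ B := dist_nonneg.trans (hB x y)
  rw [Real.coe_toNNReal _ hα0.le, edist_dist, edist_dist,
    ENNReal.ofReal_rpow_of_nonneg dist_nonneg hα0.le, ← ENNReal.ofReal.eq_def,
    ← ENNReal.ofReal_mul (by positivity)]
  refine ENNReal.ofReal_le_ofReal ((hdist x y).trans_eq ?_)
  rw [Real.div_rpow dist_nonneg hD.le]
  ring

namespace IsQuasisymmetry

variable {Z Y : Type*} [MetricSpace Z] [MetricSpace Y] {f : Z → Y}

protected theorem id (Z : Type*) [MetricSpace Z] : IsQuasisymmetry (id : Z → Z) :=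
  ⟨Homeomorph.refl _, fun _ _ _ _ h => h⟩

theorem exists_dist_le_half_mul (hf : IsQuasisymmetry f) :
    ∃ t : ℝ, 0 < t ∧ t < 1 ∧ ∀ x y z, dist x y ≤ t * dist x z →
      dist (f x) (f y) ≤ 1 / 2 * dist (f x) (f z) := by
  obtain ⟨η, hη⟩ := hf
  obtain ⟨t, ht, hηt⟩ : ∃ t : ℝ≥0, 0 < t ∧ η t ≤ 1 / 2 := by
    rcases eq_or_ne (η.symm 0) 0 with h0 | h0
    · have hη0 : Tendsto η (𝓝[>] 0) (𝓝 0) := by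
        have h := η.continuous.tendsto 0
        rw [← h0, η.apply_symm_apply, h0] at h
        exact h.mono_left nhdsWithin_le_nhds
      obtain ⟨t, hηt, ht⟩ := ((hη0.eventually_lt_const (u := 1 / 2) (by positivity)).and
        self_mem_nhdsWithin).exists
      exact ⟨t, ht, hηt.le⟩
    · exact ⟨η.symm 0, pos_iff_ne_zero.2 h0, by simp⟩
  refine ⟨min t (1 / 2), by positivity, (min_le_right _ _).trans_lt (by norm_num),
    fun x y z hxy => (hη x y z t (hxy.trans ?_)).trans ?_⟩
  · gcongr
    exact min_le_left _ _
  · gcongr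
    exact_mod_cast hηt

variable [BoundedSpace Z] [Nontrivial Z]

theorem exists_dist_le (hf : IsQuasisymmetry f) : ∃ B : ℝ, ∀ x y, dist (f x) (f y) ≤ B := by
  obtain ⟨η, hη⟩ := hf
  obtain ⟨p, q, hpq⟩ := exists_pair_ne Z
  have hpq' : dist p q ≠ 0 := dist_ne_zero.2 hpq
  set T : ℝ≥0 := (Metric.diam (univ : Set Z) / dist p q).toNNReal with hT
  have hp : ∀ x, dist (f p) (f x) ≤ η T * dist (f p) (f q) := fun x => by
    refine hη p x q T ?_
    rw [hT, Real.coe_toNNReal _ (div_nonneg Metric.diam_nonneg dist_nonneg),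
      div_mul_cancel₀ _ hpq']
    exact Metric.dist_le_diam_of_mem (Bornology.isBounded_univ.2 ‹_›) (mem_univ _) (mem_univ _)
  exact ⟨2 * (η T * dist (f p) (f q)), fun x y => by
    linarith [dist_triangle_left (f x) (f y) (f p), hp x, hp y]⟩

theorem exists_holderWith (hf : IsQuasisymmetry f) (hZ : IsUniformlyPerfect Z) :
    ∃ C α : ℝ≥0, 0 < α ∧ HolderWith C α f := by
  obtain ⟨B, hB⟩ := hf.exists_dist_le
  obtain ⟨t, ht, ht1, hft⟩ := hf.exists_dist_le_half_mul
  obtain ⟨c, hc, hperfect⟩ := hZ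
  obtain ⟨D, hD, -, hDZ⟩ := exists_ofReal_le_ediam_univ Z one_pos
  have hc1 : c < 1 := by
    obtain ⟨y, hy, hy'⟩ := hperfect (Classical.arbitrary Z) D hD hDZ
    exact (mul_lt_iff_lt_one_left hD).1 (hy.trans_lt hy')
  have htc1 : t * c < 1 := mul_lt_one_of_nonneg_of_lt_one_left ht.le ht1 hc1.le
  refine exists_holderWith_of_forall_pow (mul_pos ht hc) htc1 hD hB fun k => ?_
  induction k with
  | zero => simpa using fun x y _ => hB x y
  | succ k ih =>
    intro x y hxy
    have hr : (t * c) ^ k * D ≤ D :=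
      mul_le_of_le_one_left hD.le (pow_le_one₀ (by positivity) htc1.le)
    obtain ⟨z, hz, hz'⟩ := hperfect x ((t * c) ^ k * D) (by positivity)
      ((ENNReal.ofReal_le_ofReal hr).trans hDZ)
    have hyz : dist x y ≤ t * dist x z := by
      calc dist x y ≤ t * (c * ((t * c) ^ k * D)) := hxy.trans_eq (by ring)
        _ ≤ t * dist x z := by gcongr
    calc dist (f x) (f y) ≤ 1 / 2 * dist (f x) (f z) := hft x y z hyz
      _ ≤ 1 / 2 * ((1 / 2) ^ k * B) := by
        gcongr
        exact ih x z hz'.le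
      _ = (1 / 2) ^ (k + 1) * B := by ring

theorem exists_le_dist (hf : IsQuasisymmetry f) (hinj : Function.Injective f) {δ : ℝ}
    (hδ : 0 < δ) : ∃ δ' : ℝ, 0 < δ' ∧ ∀ x y, δ ≤ dist x y → δ' ≤ dist (f x) (f y) := by
  obtain ⟨η, hη⟩ := hf
  obtain ⟨p, q, hpq⟩ := exists_pair_ne Z
  have hpq' : 0 < dist (f p) (f q) := dist_pos.2 (hinj.ne hpq)
  set T : ℝ≥0 := (Metric.diam (univ : Set Z) / δ).toNNReal with hT
  refine ⟨dist (f p) (f q) / (2 * η T + 1), by positivity, fun x y hxy => ?_⟩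
  have hx : ∀ z, dist (f x) (f z) ≤ η T * dist (f x) (f y) := fun z => by
    refine hη x z y T ?_
    calc dist x z ≤ Metric.diam (univ : Set Z) :=
          Metric.dist_le_diam_of_mem (Bornology.isBounded_univ.2 ‹_›) (mem_univ _) (mem_univ _)
      _ = T * δ := by
        rw [hT, Real.coe_toNNReal _ (div_nonneg Metric.diam_nonneg hδ.le),
          div_mul_cancel₀ _ hδ.ne']
      _ ≤ T * dist x y := by gcongr
  rw [div_le_iff₀ (by positivity)]
  nlinarith [dist_triangle_left (f p) (f q) (f x), hx p, hx q, dist_nonneg (x := f x) (y := f y)]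

end IsQuasisymmetry

/-! ### Hyperbolic fillings -/

theorem exists_hyperbolicFilling (Z : Type*) [MetricSpace Z] [BoundedSpace Z] :
    Nonempty (HyperbolicFilling Z) := by
  choose P hP using fun k : ℕ =>
    exists_maximal_isSeparatedSet Z ((Metric.diam (univ : Set Z) + 1) * (2 : ℝ)⁻¹ ^ k)
  refine ⟨⟨2, one_lt_two, Metric.diam (univ : Set Z) + 1, ?_, P, hP⟩⟩
  have hbdd : Metric.ediam (univ : Set Z) ≠ ∞ :=
    (Bornology.isBounded_univ.2 ‹_›).ediam_ne_top
  rw [ENNReal.lt_ofReal_iff_toReal_lt hbdd]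
  exact lt_add_one _

namespace HyperbolicFilling

section Mesh

variable {Z : Type*} [MetricSpace Z] (X : HyperbolicFilling Z)

theorem s_pos : 0 < X.s := one_pos.trans X.one_lt_s

theorem R_pos : 0 < X.R := ENNReal.ofReal_pos.1 (bot_le.trans_lt X.diam_lt)

/-- The lower bound `R s⁻ᵏ` for the mutual distances of the centers of level `k`. -/
noncomputable def mesh (k : ℕ) : ℝ := X.R * X.s⁻¹ ^ k

theorem mesh_pos (k : ℕ) : 0 < X.mesh k :=
  mul_pos X.R_pos (pow_pos (inv_pos.2 X.s_pos) k)

theorem mesh_antitone : Antitone X.mesh := fun _ _ h =>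
  mul_le_mul_of_nonneg_left (pow_le_pow_of_le_one (inv_pos.2 X.s_pos).le
    (inv_le_one_of_one_le₀ X.one_lt_s.le) h) X.R_pos.le

theorem mesh_le (k : ℕ) : X.mesh k ≤ X.R :=
  (X.mesh_antitone k.zero_le).trans_eq (by rw [mesh, pow_zero, mul_one])

theorem mesh_eq_mul_mesh_succ (k : ℕ) : X.mesh k = X.s * X.mesh (k + 1) := by
  have := X.s_pos
  rw [mesh, mesh, pow_succ]
  field_simp

theorem tendsto_mesh : Tendsto X.mesh atTop (𝓝 0) := by
  have := (tendsto_pow_atTop_nhds_zero_of_lt_one (inv_pos.2 X.s_pos).le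
    (inv_lt_one_of_one_lt₀ X.one_lt_s)).const_mul X.R
  rwa [mul_zero] at this

theorem tsum_ofReal_mesh_rpow_ne_top {β : ℝ} (hβ : 0 < β) :
    ∑' k, ENNReal.ofReal (X.mesh k) ^ β ≠ ∞ := by
  have hs : 0 < X.s⁻¹ := inv_pos.2 X.s_pos
  have hpow : ∀ k, ENNReal.ofReal (X.mesh k) ^ β =
      ENNReal.ofReal (X.R ^ β * (X.s⁻¹ ^ β) ^ k) := fun k => by
    rw [ENNReal.ofReal_rpow_of_pos (X.mesh_pos k), mesh, Real.mul_rpow X.R_pos.le (by positivity),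
      Real.rpow_pow_comm hs.le]
  simp only [hpow]
  exact ((summable_geometric_of_lt_one (by positivity) (Real.rpow_lt_one hs.le
    (inv_lt_one_of_one_lt₀ X.one_lt_s) hβ)).mul_left _).tsum_ofReal_ne_top

end Mesh

section Vertices

variable {Z : Type*} [MetricSpace Z] {X : HyperbolicFilling Z}

theorem Vertex.radius_eq (v : X.Vertex) : v.radius = 2 * X.mesh v.level := rfl

theorem Vertex.radius_pos (v : X.Vertex) : 0 < v.radius := mul_pos two_pos (X.mesh_pos _)

theorem Vertex.mesh_level_le_dist {v w : X.Vertex} (hl : v.level = w.level) (hvw : v ≠ w) :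
    X.mesh v.level ≤ dist v.center w.center := by
  obtain ⟨k, x⟩ := v
  obtain ⟨l, y⟩ := w
  obtain rfl : k = l := hl
  exact (X.maximal_centers k).prop x.2 y.2 fun h => hvw (by rw [Subtype.ext h])

variable (X) in
theorem exists_vertex_dist_lt (k : ℕ) (z : Z) :
    ∃ v : X.Vertex, v.level = k ∧ dist z v.center < X.mesh k := by
  obtain ⟨x, hx, h⟩ :=
    exists_dist_lt_of_maximal_isSeparatedSet (X.mesh_pos k) (X.maximal_centers k) z
  exact ⟨⟨k, x, hx⟩, rfl, h⟩

theorem adj_of_mem_ball {v w : X.Vertex} {z : Z} (hne : v ≠ w) (h : v.level ≤ w.level + 1)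
    (h' : w.level ≤ v.level + 1) (hv : z ∈ v.ball) (hw : z ∈ w.ball) : X.graph.Adj v w :=
  ⟨hne, h, h', z, subset_closure hv, subset_closure hw⟩

theorem dist_center_le_of_adj {v w : X.Vertex} (h : X.graph.Adj v w) (hl : w.level ≤ v.level) :
    dist v.center w.center ≤ 4 * X.mesh w.level := by
  obtain ⟨z, hz, hz'⟩ := h.2.2.2
  have hv : dist z v.center ≤ v.radius := Metric.closure_ball_subset_closedBall hz
  have hw : dist z w.center ≤ w.radius := Metric.closure_ball_subset_closedBall hz'
  rw [v.radius_eq] at hv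
  rw [w.radius_eq] at hw
  linarith [X.mesh_antitone hl, dist_triangle_left v.center w.center z]

theorem mesh_le_of_adj {v w : X.Vertex} (h : X.graph.Adj v w) :
    X.mesh w.level ≤ X.s * X.mesh v.level := by
  rcases lt_or_ge w.level v.level with hl | hl
  · rw [le_antisymm h.2.1 hl, ← X.mesh_eq_mul_mesh_succ]
  · exact (X.mesh_antitone hl).trans (le_mul_of_one_le_left (X.mesh_pos _).le X.one_lt_s.le)

variable [Nontrivial Z] [MeasurableSpace Z] [OpensMeasurableSpace Z] {μ : Measure Z}
  [IsFiniteMeasure μ] {Q : ℝ}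

variable (X) in
theorem exists_encard_vertex_le (hQ : 0 < Q) (hμ : IsAhlforsRegular μ Q) {K : ℝ} (hK : 0 < K) :
    ∃ M : ℕ, ∀ (k : ℕ) (z : Z),
      {v : X.Vertex | v.level = k ∧ dist v.center z < K * X.mesh k}.encard ≤ M := by
  obtain ⟨M, hM⟩ := hμ.exists_encard_inter_ball_le hQ X.R_pos hK
  refine ⟨M, fun k z => (Set.encard_le_encard_of_injOn (f := Vertex.center) ?_ ?_).trans
    (hM _ (X.mesh_pos k) (X.mesh_le k) _ (X.maximal_centers k).prop z)⟩
  · rintro ⟨l, x⟩ ⟨rfl, h⟩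
    exact ⟨x.2, h⟩
  · rintro v ⟨hv, -⟩ w ⟨hw, -⟩ h
    by_contra hvw
    have hdist := Vertex.mesh_level_le_dist (hv.trans hw.symm) hvw
    rw [show v.center = w.center from h, dist_self] at hdist
    exact hdist.not_gt (X.mesh_pos _)

variable (X) in
theorem finite_level (hμ : IsAhlforsRegular μ Q) (k : ℕ) : {v : X.Vertex | v.level = k}.Finite := by
  have := (hμ.finite_of_isSeparatedSet (X.mesh_pos k) (X.maximal_centers k).prop).to_subtype
  refine (finite_range fun x : X.centers k => (⟨k, x⟩ : X.Vertex)).subset ?_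
  rintro ⟨l, x⟩ rfl
  exact ⟨x, rfl⟩

variable (X) in
theorem countable_vertex (hμ : IsAhlforsRegular μ Q) : Countable X.Vertex := by
  refine countable_univ_iff.1
    ((countable_iUnion fun k => (X.finite_level hμ k).countable).mono ?_)
  exact fun v _ => mem_iUnion.2 ⟨v.level, rfl⟩

variable (X) in
theorem exists_encard_adj_le (hQ : 0 < Q) (hμ : IsAhlforsRegular μ Q) :
    ∃ M : ℕ, ∀ v : X.Vertex, {w | X.graph.Adj v w ∧ w.level ≤ v.level}.encard ≤ M := by
  obtain ⟨M, hM⟩ := X.exists_encard_vertex_le hQ hμ (K := 5) (by norm_num)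
  refine ⟨M + M, fun v => ?_⟩
  push_cast
  refine le_trans ?_ (add_le_add (hM v.level v.center) (hM (v.level - 1) v.center))
  refine (encard_le_encard ?_).trans (encard_union_le _ _)
  rintro w ⟨hw, hl⟩
  have hd : dist w.center v.center < 5 * X.mesh w.level := by
    rw [dist_comm]
    linarith [dist_center_le_of_adj hw hl, X.mesh_pos w.level]
  rcases hl.lt_or_eq with hl | hl
  · have hpred : w.level = v.level - 1 := by
      have := hw.2.1
      omega
    exact .inr ⟨hpred, hpred ▸ hd⟩
  · exact .inl ⟨hl, hl ▸ hd⟩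

end Vertices

section Sums

variable {Z : Type*} [MetricSpace Z] {X : HyperbolicFilling Z}

/-- Each edge is charged to its end point of higher level. -/
theorem tsum_edge_le_mul_tsum_vertex {M : ℕ}
    (hM : ∀ v : X.Vertex, {w | X.graph.Adj v w ∧ w.level ≤ v.level}.encard ≤ M)
    {τ : X.graph.edgeSet → ℝ≥0∞} {b : X.Vertex → ℝ≥0∞}
    (hb : ∀ v w (h : X.graph.Adj v w), w.level ≤ v.level → τ ⟨s(v, w), h⟩ ≤ b v) :
    ∑' e, τ e ≤ M * ∑' v, b v := by
  have hex : ∀ e : X.graph.edgeSet, ∃ v w, s(v, w) = e.1 ∧ w.level ≤ v.level := by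
    rintro ⟨e, -⟩
    induction e using Sym2.ind with
    | h v w =>
      rcases le_total v.level w.level with h | h
      · exact ⟨w, v, Sym2.eq_swap, h⟩
      · exact ⟨v, w, rfl, h⟩
  choose v w hvw hl using hex
  have hadj : ∀ e, X.graph.Adj (v e) (w e) := fun e => by
    rw [← SimpleGraph.mem_edgeSet, hvw]
    exact e.2
  calc ∑' e, τ e ≤ ∑' e, b (v e) := ENNReal.tsum_le_tsum fun e => by
        have he : e = ⟨s(v e, w e), hadj e⟩ := Subtype.ext (hvw e).symm
        exact (congrArg τ he).trans_le (hb _ _ (hadj e) (hl e))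
    _ ≤ M * ∑' v, b v := by
        refine tsum_comp_le_of_encard_preimage_le (fun u => ?_) b
        refine (encard_le_encard_of_injOn (f := w) ?_ ?_).trans (hM u)
        · rintro e rfl
          exact ⟨hadj e, hl e⟩
        · rintro e rfl e' he' h
          rw [Subtype.ext_iff, ← hvw e, ← hvw e', h, show v e' = v e from he']

theorem tsum_mul_measure_le {Y : Type*} [MeasurableSpace Y] (ν : Measure Y)
    {U : X.Vertex → Set Y} (hU : ∀ v, MeasurableSet (U v))
    (hdisj : ∀ v w, v.level = w.level → v ≠ w → Disjoint (U v) (U w)) (g : ℕ → ℝ≥0∞) :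
    ∑' v : X.Vertex, g v.level * ν (U v) ≤ (∑' k, g k) * ν univ := by
  refine (ENNReal.tsum_sigma' fun v : X.Vertex => g v.level * ν (U v)).trans_le ?_
  rw [← ENNReal.tsum_mul_right]
  refine ENNReal.tsum_le_tsum fun k => ?_
  change ∑' x : X.centers k, g k * ν (U ⟨k, x⟩) ≤ _
  rw [ENNReal.tsum_mul_left]
  gcongr
  refine (tsum_meas_le_meas_iUnion_of_disjoint ν (As := fun x : X.centers k => U ⟨k, x⟩)
    (fun x => hU _) fun x y hxy => hdisj _ _ rfl fun h => hxy ?_).trans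
    (measure_mono (subset_univ _))
  exact eq_of_heq (Sigma.mk.inj h).2

end Sums

end HyperbolicFilling

/-! ### Finiteness of the weak capacity above the dimension of a quasisymmetric image -/

theorem edist_le_tsum_edist {Y : Type*} [PseudoEMetricSpace Y] (u : ℤ → Y) (N : ℕ) :
    edist (u (-N)) (u N) ≤ ∑' k : ℤ, edist (u k) (u (k + 1)) := by
  have hinj : Function.Injective fun j : ℕ => -(N : ℤ) + j := fun i j h => by simpa using h
  calc edist (u (-N)) (u N) = edist (u (-N + (0 : ℕ))) (u (-N + (2 * N : ℕ))) := by
        congr 2 <;> push_cast <;> ring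
    _ ≤ ∑ j ∈ Finset.range (2 * N), edist (u (-N + j)) (u (-N + (j + 1 : ℕ))) :=
        edist_le_range_sum_edist (fun j : ℕ => u (-N + j)) (2 * N)
    _ = ∑ j ∈ Finset.range (2 * N), edist (u (-N + j)) (u (-N + j + 1)) := by
        simp only [Nat.cast_succ, add_assoc]
    _ ≤ ∑' j : ℕ, edist (u (-N + j)) (u (-N + j + 1)) := ENNReal.sum_le_tsum _
    _ ≤ ∑' k : ℤ, edist (u k) (u (k + 1)) :=
        ENNReal.tsum_comp_le_tsum_of_injective hinj fun k => edist (u k) (u (k + 1))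

theorem le_dist_of_le_setDist {Z : Type*} [MetricSpace Z] {A B : Set Z} {a b : Z} {δ : ℝ}
    (h : ENNReal.ofReal δ ≤ setDist A B) (ha : a ∈ A) (hb : b ∈ B) : δ ≤ dist a b := by
  have hab : setDist A B ≤ edist a b := iInf₂_le_of_le a ha (iInf₂_le b hb)
  exact (ENNReal.ofReal_le_ofReal_iff dist_nonneg).1 ((h.trans hab).trans_eq (edist_dist a b))

namespace HyperbolicFilling

variable {Z Y : Type*} [MetricSpace Z] [MetricSpace Y] (X : HyperbolicFilling Z)

/-- The distance in `Y` of the images of the centers of the end points of an edge. -/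
noncomputable def edgeDist (f : Z → Y) (e : X.graph.edgeSet) : ℝ≥0∞ :=
  Sym2.lift ⟨fun v w : X.Vertex => edist (f v.center) (f w.center), fun _ _ => edist_comm _ _⟩ e.1

theorem isAdmissible_edgeDist_div {f : Z → Y} (hf : Continuous f) {A B : Set Z} {δ : ℝ≥0∞}
    (h0 : δ ≠ 0) (ht : δ ≠ ∞) (h : ∀ a ∈ A, ∀ b ∈ B, δ ≤ edist (f a) (f b)) :
    X.IsAdmissible A B fun e => X.edgeDist f e / δ := by
  intro v hv a ha b hb hva hvb
  have hle : edist (f a) (f b) ≤ ∑' k : ℤ, edist (f (v k).center) (f (v (k + 1)).center) :=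
    le_of_tendsto' (((hf.tendsto a).comp hva.1).edist ((hf.tendsto b).comp hvb.1)) fun N =>
      edist_le_tsum_edist (fun k => f (v k).center) N
  simp only [div_eq_mul_inv]
  rw [ENNReal.tsum_mul_right, ← div_eq_mul_inv, ENNReal.le_div_iff_mul_le (.inl h0) (.inl ht),
    one_mul]
  exact (h a ha b hb).trans hle

variable {X}

theorem exists_ball_subset_image {f : Z → Y} (hf : IsQuasisymmetry f)
    (hsurj : Function.Surjective f) :
    ∃ t : ℝ, 1 ≤ t ∧ ∀ v w : X.Vertex, X.graph.Adj v w → w.level ≤ v.level →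
      Metric.ball (f v.center) (dist (f v.center) (f w.center) / t) ⊆
        f '' Metric.ball v.center (X.mesh v.level / 2) := by
  obtain ⟨η, hη⟩ := hf
  have hs := X.s_pos
  refine ⟨max 1 (η (8 * X.s.toNNReal)), le_max_left _ _, fun v w hvw hl y hy => ?_⟩
  obtain ⟨z, rfl⟩ := hsurj y
  refine mem_image_of_mem f ?_
  by_contra hz
  rw [Metric.mem_ball, not_lt, dist_comm] at hz
  have hdist : dist v.center w.center ≤ (8 * X.s.toNNReal : ℝ≥0) * dist v.center z := by
    calc dist v.center w.center ≤ 4 * (X.s * X.mesh v.level) :=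
          (dist_center_le_of_adj hvw hl).trans (by gcongr; exact mesh_le_of_adj hvw)
      _ = 8 * X.s * (X.mesh v.level / 2) := by ring
      _ ≤ 8 * X.s * dist v.center z := by gcongr
      _ = (8 * X.s.toNNReal : ℝ≥0) * dist v.center z := by
        rw [NNReal.coe_mul, Real.coe_toNNReal _ hs.le, NNReal.coe_ofNat]
  rw [Metric.mem_ball', lt_div_iff₀ (by positivity), mul_comm] at hy
  refine hy.not_ge ((hη _ _ _ _ hdist).trans ?_)
  gcongr
  exact le_max_right _ _

theorem disjoint_ball_half_mesh {v w : X.Vertex} (hl : v.level = w.level) (hvw : v ≠ w) :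
    Disjoint (Metric.ball v.center (X.mesh v.level / 2))
      (Metric.ball w.center (X.mesh w.level / 2)) := by
  refine Metric.ball_disjoint_ball ?_
  rw [← hl, add_halves]
  exact Vertex.mesh_level_le_dist hl hvw

theorem exists_edist_rpow_le_mul_measure [MeasurableSpace Y] {f : Z → Y} (hf : IsQuasisymmetry f)
    (hsurj : Function.Surjective f) {B : ℝ} (hB : ∀ x y, dist (f x) (f y) ≤ B) {c Q : ℝ}
    (hc : 0 < c) (hQ : 0 < Q) {ν : Measure Y}
    (hν : ∀ y r, 0 < r → r ≤ B → ENNReal.ofReal (c * r ^ Q) ≤ ν (Metric.ball y r)) :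
    ∃ K : ℝ≥0∞, K ≠ ∞ ∧ ∀ v w : X.Vertex, X.graph.Adj v w → w.level ≤ v.level →
      edist (f v.center) (f w.center) ^ Q ≤
        K * ν (interior (f '' Metric.ball v.center (X.mesh v.level / 2))) := by
  obtain ⟨t, ht, hft⟩ := exists_ball_subset_image (X := X) hf hsurj
  have ht0 : 0 < t := one_pos.trans_le ht
  refine ⟨ENNReal.ofReal (t ^ Q / c), ENNReal.ofReal_ne_top, fun v w hvw hl => ?_⟩
  rcases eq_or_ne (f v.center) (f w.center) with h0 | h0
  · rw [h0, edist_self, ENNReal.zero_rpow_of_pos hQ]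
    exact zero_le
  have hd : 0 < dist (f v.center) (f w.center) := dist_pos.2 h0
  calc edist (f v.center) (f w.center) ^ Q
      = ENNReal.ofReal (t ^ Q / c) *
          ENNReal.ofReal (c * (dist (f v.center) (f w.center) / t) ^ Q) := by
        rw [edist_dist, ENNReal.ofReal_rpow_of_pos hd, ← ENNReal.ofReal_mul (by positivity),
          Real.div_rpow hd.le ht0.le]
        congr 1
        field_simp
    _ ≤ _ := by
        gcongr
        exact (hν _ _ (by positivity) ((div_le_self hd.le ht).trans (hB _ _))).trans
          (measure_mono (interior_maximal (hft v w hvw hl) Metric.isOpen_ball))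

theorem edist_rpow_le_mul_mesh_rpow {f : Z → Y} {C α : ℝ≥0} (hf : HolderWith C α f) {β : ℝ}
    (hβ : 0 ≤ β) {v w : X.Vertex} (hvw : X.graph.Adj v w) (hl : w.level ≤ v.level) :
    edist (f v.center) (f w.center) ^ β ≤
      (C * ENNReal.ofReal (4 * X.s) ^ (α : ℝ)) ^ β * ENNReal.ofReal (X.mesh v.level) ^ (α * β) := by
  have hs := X.s_pos
  have hdist : edist v.center w.center ≤
      ENNReal.ofReal (4 * X.s) * ENNReal.ofReal (X.mesh v.level) := by
    rw [edist_dist, ← ENNReal.ofReal_mul (by positivity), mul_assoc]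
    refine ENNReal.ofReal_le_ofReal ((dist_center_le_of_adj hvw hl).trans ?_)
    gcongr
    exact mesh_le_of_adj hvw
  rw [ENNReal.rpow_mul, ← ENNReal.mul_rpow_of_nonneg _ _ hβ, mul_assoc,
    ← ENNReal.mul_rpow_of_nonneg _ _ α.coe_nonneg]
  gcongr
  exact (hf.edist_le _ _).trans (by gcongr)

section Finiteness

variable [BoundedSpace Z] [Nontrivial Z] [MeasurableSpace Y] [BorelSpace Y] {ν : Measure Y}
  [IsFiniteMeasure ν] {Q' q : ℝ} {f : Z → Y}

theorem tsum_edgeDist_rpow_ne_top (hZ : IsUniformlyPerfect Z) {M : ℕ}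
    (hM : ∀ v : X.Vertex, {w | X.graph.Adj v w ∧ w.level ≤ v.level}.encard ≤ M)
    (hQ' : 0 < Q') (hν : IsAhlforsRegular ν Q') (hf : IsQuasisymmetry f)
    (hbij : Function.Bijective f) (hq : Q' < q) : ∑' e, X.edgeDist f e ^ q ≠ ∞ := by
  have := hbij.1.nontrivial
  obtain ⟨B, hB⟩ := hf.exists_dist_le
  obtain ⟨C, α, hα, hfα⟩ := hf.exists_holderWith hZ
  obtain ⟨x, y, hxy⟩ := exists_pair_ne Z
  obtain ⟨c, hc, hνc⟩ := hν.exists_le_measure_ball ((dist_pos.2 (hbij.1.ne hxy)).trans_le (hB x y))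
  obtain ⟨K, hK, hfK⟩ := exists_edist_rpow_le_mul_measure (X := X) hf hbij.2 hB hc hQ' hνc
  have hβ : 0 < q - Q' := sub_pos.2 hq
  set L : ℝ≥0∞ := (C * ENNReal.ofReal (4 * X.s) ^ (α : ℝ)) ^ (q - Q')
  have hLtop : L ≠ ∞ := by finiteness
  set U : X.Vertex → Set Y := fun v => interior (f '' Metric.ball v.center (X.mesh v.level / 2))
  have hedge : ∀ v w (h : X.graph.Adj v w), w.level ≤ v.level → X.edgeDist f ⟨s(v, w), h⟩ ^ q ≤
      L * K * (ENNReal.ofReal (X.mesh v.level) ^ (α * (q - Q')) * ν (U v)) := fun v w h hl => by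
    calc edist (f v.center) (f w.center) ^ q
        = edist (f v.center) (f w.center) ^ (q - Q') * edist (f v.center) (f w.center) ^ Q' := by
          rw [← ENNReal.rpow_add_of_nonneg _ _ hβ.le hQ'.le, sub_add_cancel]
      _ ≤ L * ENNReal.ofReal (X.mesh v.level) ^ (α * (q - Q')) * (K * ν (U v)) :=
          mul_le_mul' (edist_rpow_le_mul_mesh_rpow hfα hβ.le h hl) (hfK v w h hl)
      _ = _ := by ring
  have hdisj : ∀ v w : X.Vertex, v.level = w.level → v ≠ w → Disjoint (U v) (U w) :=
    fun v w hl hvw => ((disjoint_image_iff hbij.1).2 (disjoint_ball_half_mesh hl hvw)).mono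
      interior_subset interior_subset
  refine ne_top_of_le_ne_top ?_ (tsum_edge_le_mul_tsum_vertex hM hedge)
  rw [ENNReal.tsum_mul_left]
  refine ENNReal.mul_ne_top (ENNReal.natCast_ne_top M) (ENNReal.mul_ne_top (by finiteness)
    (ne_top_of_le_ne_top ?_ (tsum_mul_measure_le ν (fun v => isOpen_interior.measurableSet) hdisj
      fun k => ENNReal.ofReal (X.mesh k) ^ (α * (q - Q')))))
  exact ENNReal.mul_ne_top (X.tsum_ofReal_mesh_rpow_ne_top (by positivity)) (measure_ne_top _ _)

theorem wcap_lt_top_of_isQuasisymmetry (hZ : IsUniformlyPerfect Z) {M : ℕ}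
    (hM : ∀ v : X.Vertex, {w | X.graph.Adj v w ∧ w.level ≤ v.level}.encard ≤ M)
    (hQ' : 0 < Q') (hν : IsAhlforsRegular ν Q') (hf : IsQuasisymmetry f)
    (hbij : Function.Bijective f) (hq : Q' < q) {A B : Set Z} (hAB : 0 < setDist A B) :
    X.wcap q A B < ∞ := by
  have hq0 : 0 < q := hQ'.trans hq
  obtain ⟨C, α, hα, hfα⟩ := hf.exists_holderWith hZ
  obtain ⟨δ, -, hδAB⟩ := ENNReal.lt_iff_exists_real_btwn.1 hAB
  obtain ⟨δ', hδ', hfδ⟩ := hf.exists_le_dist hbij.1 (ENNReal.ofReal_pos.1 hδAB.1)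
  have hadm : X.IsAdmissible A B fun e => X.edgeDist f e / ENNReal.ofReal δ' :=
    X.isAdmissible_edgeDist_div (hfα.continuous hα) (ENNReal.ofReal_pos.2 hδ').ne'
      ENNReal.ofReal_ne_top fun a ha b hb => by
        rw [edist_dist]
        exact ENNReal.ofReal_le_ofReal (hfδ a b (le_dist_of_le_setDist hδAB.2.le ha hb))
  refine (iInf₂_le _ hadm).trans_lt (ENNReal.rpow_lt_top_of_nonneg hq0.le
    (weakNorm_lt_top_of_tsum_rpow_ne_top hq0 ?_).ne)
  simp only [div_eq_mul_inv, ENNReal.mul_rpow_of_nonneg _ _ hq0.le]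
  rw [ENNReal.tsum_mul_right]
  refine ENNReal.mul_ne_top (tsum_edgeDist_rpow_ne_top hZ hM hQ' hν hf hbij hq) ?_
  exact ENNReal.rpow_ne_top_of_nonneg hq0.le
    (ENNReal.inv_ne_top.2 (ENNReal.ofReal_pos.2 hδ').ne')

end Finiteness

end HyperbolicFilling

/-! ### Line integrals -/

namespace MetricPath

variable {Z : Type*} [MetricSpace Z] (γ : MetricPath Z)

theorem lineIntegral_mono {ρ ρ' : Z → ℝ≥0∞} (h : ρ ≤ ρ') : γ.lineIntegral ρ ≤ γ.lineIntegral ρ' :=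
  lintegral_mono fun _ => h _

theorem isPreconnected_image : IsPreconnected (γ.toFun '' γ.dom) :=
  γ.ordConnected.isPreconnected.image _ γ.continuousOn

/-- The set of arclength parameters of a path. -/
noncomputable def arclengthSet : Set ℝ :=
  variationOnFromTo γ.toFun γ.dom γ.nonempty.some '' γ.dom

/-- The arclength parameterization of a path; only its values on `arclengthSet` are meaningful. -/
noncomputable def arclengthParam : ℝ → Z :=
  naturalParameterization γ.toFun γ.dom γ.nonempty.some

/-- The distribution of arclength along a rectifiable path. -/
noncomputable def arclengthMeasure [MeasurableSpace Z] : Measure Z :=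
  (volume.restrict γ.arclengthSet).map γ.arclengthParam

variable {γ}

theorem Nonconstant.nontrivial_image (hγ : γ.Nonconstant) : (γ.toFun '' γ.dom).Nontrivial := by
  obtain ⟨t, ht, t', ht', hne⟩ := hγ
  exact ⟨_, mem_image_of_mem _ ht, _, mem_image_of_mem _ ht', hne⟩

namespace Rectifiable

theorem measurableSet_arclengthSet (hγ : γ.Rectifiable) : MeasurableSet γ.arclengthSet :=
  γ.ordConnected.measurableSet.image_of_monotoneOn
    (variationOnFromTo.monotoneOn (BoundedVariationOn.locallyBoundedVariationOn hγ)
      γ.nonempty.some_mem)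

theorem image_subset_arclengthParam_image (hγ : γ.Rectifiable) :
    γ.toFun '' γ.dom ⊆ γ.arclengthParam '' γ.arclengthSet := by
  rintro _ ⟨t, ht, rfl⟩
  exact ⟨_, mem_image_of_mem _ ht, edist_eq_zero.1 (edist_naturalParameterization_eq_zero
    (BoundedVariationOn.locallyBoundedVariationOn hγ) γ.nonempty.some_mem ht)⟩

theorem lipschitzOnWith_arclengthParam (hγ : γ.Rectifiable) :
    LipschitzOnWith 1 γ.arclengthParam γ.arclengthSet := by
  have hspeed := has_unit_speed_naturalParameterization γ.toFun
    (BoundedVariationOn.locallyBoundedVariationOn hγ) γ.nonempty.some_mem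
  have hle : ∀ x ∈ γ.arclengthSet, ∀ y ∈ γ.arclengthSet, x ≤ y →
      edist (γ.arclengthParam x) (γ.arclengthParam y) ≤ edist x y := by
    intro x hx y hy hxy
    refine (eVariationOn.edist_le _ (s := γ.arclengthSet ∩ Icc x y) ⟨hx, le_rfl, hxy⟩
      ⟨hy, hxy, le_rfl⟩).trans ((hspeed hx hy).trans_le ?_)
    rw [edist_comm, edist_dist, Real.dist_eq, abs_of_nonneg (sub_nonneg.2 hxy), NNReal.coe_one,
      one_mul]
  intro x hx y hy
  rw [ENNReal.coe_one, one_mul]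
  rcases le_total x y with hxy | hxy
  · exact hle x hx y hy hxy
  · rw [edist_comm, edist_comm x]
    exact hle y hy x hx hxy

variable [MeasurableSpace Z] [BorelSpace Z]

theorem aemeasurable_arclengthParam (hγ : γ.Rectifiable) :
    AEMeasurable γ.arclengthParam (volume.restrict γ.arclengthSet) :=
  hγ.lipschitzOnWith_arclengthParam.continuousOn.aemeasurable hγ.measurableSet_arclengthSet

theorem lineIntegral_eq_lintegral (hγ : γ.Rectifiable) {ρ : Z → ℝ≥0∞} (hρ : Measurable ρ) :
    γ.lineIntegral ρ = ∫⁻ z, ρ z ∂γ.arclengthMeasure :=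
  (lintegral_map' hρ.aemeasurable hγ.aemeasurable_arclengthParam).symm

theorem hausdorffMeasure_one_image_inter_le (hγ : γ.Rectifiable) {A : Set Z}
    (hA : MeasurableSet A) : μH[1] (γ.toFun '' γ.dom ∩ A) ≤ γ.arclengthMeasure A := by
  have hsub : γ.toFun '' γ.dom ∩ A ⊆
      γ.arclengthParam '' (γ.arclengthParam ⁻¹' A ∩ γ.arclengthSet) := by
    rw [image_preimage_inter, inter_comm]
    exact inter_subset_inter_right A hγ.image_subset_arclengthParam_image
  calc μH[1] (γ.toFun '' γ.dom ∩ A)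
      ≤ μH[1] (γ.arclengthParam '' (γ.arclengthParam ⁻¹' A ∩ γ.arclengthSet)) :=
        measure_mono hsub
    _ ≤ volume (γ.arclengthParam ⁻¹' A ∩ γ.arclengthSet) := by
        have hlip := hγ.lipschitzOnWith_arclengthParam.mono
          (inter_subset_right (s := γ.arclengthParam ⁻¹' A))
        simpa [hausdorffMeasure_real] using hlip.hausdorffMeasure_image_le zero_le_one
    _ ≤ γ.arclengthMeasure A := by
        rw [arclengthMeasure, Measure.map_apply_of_aemeasurable hγ.aemeasurable_arclengthParam hA]
        exact Measure.le_restrict_apply _ _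

end Rectifiable

end MetricPath

/-- The density `∑ i ∈ F, (c i / r i) 1_{B(x i, 2 r i)}`, whose integral along a path is at least
the sum of the `c i` over all balls `B(x i, r i)` which the path meets, provided that it leaves the
balls of twice the radius. -/
noncomputable def ballDensity {Z ι : Type*} [MetricSpace Z] (F : Finset ι) (x : ι → Z) (r : ι → ℝ)
    (c : ι → ℝ≥0∞) (z : Z) : ℝ≥0∞ :=
  ∑ i ∈ F, (Metric.ball (x i) (2 * r i)).indicator (fun _ => c i / ENNReal.ofReal (r i)) z

section BallDensity

variable {Z ι : Type*} [MetricSpace Z] {F G : Finset ι} {x : ι → Z} {r : ι → ℝ} {c : ι → ℝ≥0∞}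

theorem ballDensity_rpow_le {Q : ℝ} (hQ : 1 ≤ Q) {M : ℕ} {z : Z}
    (hM : {i | i ∈ F ∧ dist (x i) z < 2 * r i}.encard ≤ M) :
    ballDensity F x r c z ^ Q ≤ (M : ℝ≥0∞) ^ (Q - 1) * ∑ i ∈ F,
      (Metric.ball (x i) (2 * r i)).indicator (fun _ => (c i / ENNReal.ofReal (r i)) ^ Q) z := by
  classical
  set G := F.filter fun i => z ∈ Metric.ball (x i) (2 * r i)
  have hGM : (G.card : ℝ≥0∞) ≤ M := by
    have hsub : (G : Set ι) ⊆ {i | i ∈ F ∧ dist (x i) z < 2 * r i} := fun i hi => by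
      obtain ⟨hiF, hiz⟩ := Finset.mem_filter.1 hi
      exact ⟨hiF, Metric.mem_ball'.1 hiz⟩
    have hcard := (encard_le_encard hsub).trans hM
    rw [encard_coe_eq_coe_finsetCard] at hcard
    exact_mod_cast hcard
  simp only [ballDensity, indicator_apply, ← Finset.sum_filter]
  refine (ENNReal.rpow_sum_le_const_mul_sum_rpow G _ hQ).trans ?_
  gcongr

variable [MeasurableSpace Z]

theorem measurable_ballDensity [OpensMeasurableSpace Z] : Measurable (ballDensity F x r c) :=
  Finset.measurable_sum F fun _ _ => measurable_const.indicator Metric.isOpen_ball.measurableSet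

theorem MetricPath.Rectifiable.sum_le_lineIntegral_ballDensity [BorelSpace Z] {γ : MetricPath Z}
    (hγ : γ.Rectifiable) (hGF : G ⊆ F) (hr : ∀ i ∈ G, 0 < r i)
    (hmeet : ∀ i ∈ G, ∃ y ∈ γ.toFun '' γ.dom, dist (x i) y ≤ r i)
    (hleave : ∀ i ∈ G, ∃ y ∈ γ.toFun '' γ.dom, 2 * r i ≤ dist (x i) y) :
    ∑ i ∈ G, c i ≤ γ.lineIntegral (ballDensity F x r c) := by
  rw [hγ.lineIntegral_eq_lintegral measurable_ballDensity]
  simp only [ballDensity]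
  rw [lintegral_finsetSum F fun _ _ => measurable_const.indicator Metric.isOpen_ball.measurableSet]
  refine (Finset.sum_le_sum fun i hi => ?_).trans (Finset.sum_le_sum_of_subset hGF)
  rw [lintegral_indicator_const Metric.isOpen_ball.measurableSet]
  obtain ⟨y, hy, hyr⟩ := hmeet i hi
  obtain ⟨z, hz, hzr⟩ := hleave i hi
  have hlength : ENNReal.ofReal (r i) ≤ γ.arclengthMeasure (Metric.ball (x i) (2 * r i)) := by
    calc ENNReal.ofReal (r i) = ENNReal.ofReal (2 * r i - r i) := by ring_nf
      _ ≤ μH[1] (γ.toFun '' γ.dom ∩ Metric.ball (x i) (2 * r i)) :=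
        ofReal_sub_le_hausdorffMeasure_one_inter_ball γ.isPreconnected_image hy hyr hz hzr
      _ ≤ _ := hγ.hausdorffMeasure_one_image_inter_le Metric.isOpen_ball.measurableSet
  calc c i = c i / ENNReal.ofReal (r i) * ENNReal.ofReal (r i) :=
        (ENNReal.div_mul_cancel (ENNReal.ofReal_pos.2 (hr i hi)).ne' ENNReal.ofReal_ne_top).symm
    _ ≤ _ := by gcongr

theorem lintegral_ballDensity_rpow_le [OpensMeasurableSpace Z] {μ : Measure Z} {Q C : ℝ}
    (hQ : 1 ≤ Q) (hμ : ∀ z s, 0 < s → μ (Metric.ball z s) ≤ ENNReal.ofReal (C * s ^ Q)) {M : ℕ}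
    (hM : ∀ z, {i | i ∈ F ∧ dist (x i) z < 2 * r i}.encard ≤ M) (hr : ∀ i ∈ F, 0 < r i) :
    ∫⁻ z, ballDensity F x r c z ^ Q ∂μ ≤
      (M : ℝ≥0∞) ^ (Q - 1) * ENNReal.ofReal (C * 2 ^ Q) * ∑ i ∈ F, c i ^ Q := by
  have hQ0 : 0 < Q := one_pos.trans_le hQ
  set a : ι → ℝ≥0∞ := fun i => (c i / ENNReal.ofReal (r i)) ^ Q
  have hmass : ∀ i ∈ F, a i * μ (Metric.ball (x i) (2 * r i)) ≤
      ENNReal.ofReal (C * 2 ^ Q) * c i ^ Q := fun i hi => by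
    have hri := hr i hi
    calc a i * μ (Metric.ball (x i) (2 * r i))
        ≤ a i * ENNReal.ofReal (C * (2 * r i) ^ Q) := by
          gcongr
          exact hμ _ _ (by positivity)
      _ = ENNReal.ofReal (C * 2 ^ Q) * (a i * ENNReal.ofReal (r i) ^ Q) := by
          rw [Real.mul_rpow two_pos.le hri.le, ← mul_assoc, ENNReal.ofReal_mul' (by positivity),
            ENNReal.ofReal_rpow_of_pos hri]
          ring
      _ = _ := by
          rw [← ENNReal.mul_rpow_of_nonneg _ _ hQ0.le,
            ENNReal.div_mul_cancel (ENNReal.ofReal_pos.2 hri).ne' ENNReal.ofReal_ne_top]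
  refine (lintegral_mono fun z => ballDensity_rpow_le hQ (hM z)).trans ?_
  rw [lintegral_const_mul _ (Finset.measurable_sum F fun _ _ => measurable_const.indicator
    Metric.isOpen_ball.measurableSet), lintegral_finsetSum F fun _ _ => measurable_const.indicator
    Metric.isOpen_ball.measurableSet, mul_assoc]
  rw [Finset.mul_sum F _ (ENNReal.ofReal _)]
  refine mul_le_mul' le_rfl (Finset.sum_le_sum fun i hi => ?_)
  rw [lintegral_indicator_const Metric.isOpen_ball.measurableSet]
  exact hmass i hi

end BallDensity

/-! ### Modulus of path families -/

theorem lintegral_iSup_rpow_le_tsum {α ι : Type*} [MeasurableSpace α] [Countable ι] {μ : Measure α}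
    {p : ℝ} (hp : 0 < p) {f : ι → α → ℝ≥0∞} (hf : ∀ i, Measurable (f i)) :
    ∫⁻ x, (⨆ i, f i x) ^ p ∂μ ≤ ∑' i, ∫⁻ x, f i x ^ p ∂μ := by
  rw [← lintegral_tsum fun i => ((hf i).pow_const p).aemeasurable]
  exact lintegral_mono fun _ => iSup_rpow_le_tsum_rpow _ hp

theorem setDist_ball_pos {Z : Type*} [MetricSpace Z] {x y : Z} (hxy : x ≠ y) :
    0 < setDist (Metric.ball x (dist x y / 3)) (Metric.ball y (dist x y / 3)) := by
  have hpos := dist_pos.2 hxy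
  refine (ENNReal.ofReal_pos.2 (show 0 < dist x y / 3 by positivity)).trans_le
    (le_iInf₂ fun z hz => le_iInf₂ fun w hw => ?_)
  rw [edist_dist]
  refine ENNReal.ofReal_le_ofReal ?_
  linarith [dist_triangle4 x z w y, Metric.mem_ball'.1 hz, Metric.mem_ball.1 hw]

section Modulus

variable {Z : Type*} [MetricSpace Z] [MeasurableSpace Z] {μ : Measure Z} {p : ℝ}
  {Γ : Set (MetricPath Z)}

theorem pathModulus_eq_zero_iff : pathModulus μ p Γ = 0 ↔
    ∀ ε > 0, ∃ ρ, IsModulusAdmissible Γ ρ ∧ ∫⁻ z, ρ z ^ p ∂μ ≤ ε := by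
  refine ⟨fun h ε hε => ?_, fun h => le_antisymm (le_of_forall_gt_imp_ge_of_dense fun ε hε => ?_)
    zero_le⟩
  · obtain ⟨ρ, hρ⟩ := iInf_lt_iff.1 (h.trans_lt hε)
    obtain ⟨hadm, hlt⟩ := iInf_lt_iff.1 hρ
    exact ⟨ρ, hadm, hlt.le⟩
  · obtain ⟨ρ, hadm, hρ⟩ := h ε hε
    exact (iInf₂_le ρ hadm).trans hρ

theorem pathModulus_mono {Γ' : Set (MetricPath Z)} (hΓ : Γ ⊆ Γ') :
    pathModulus μ p Γ ≤ pathModulus μ p Γ' :=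
  le_iInf₂ fun ρ hρ => iInf₂_le ρ ⟨hρ.1, fun γ hγ => hρ.2 γ (hΓ hγ)⟩

theorem nonempty_of_pathModulus_pos (hp : 0 < p) (h : 0 < pathModulus μ p Γ) : Γ.Nonempty := by
  by_contra! hΓ
  refine h.ne' (le_antisymm ((iInf₂_le 0 ⟨measurable_zero, by simp [hΓ]⟩).trans_eq ?_) zero_le)
  simp [hp]

theorem pathModulus_iUnion_eq_zero {ι : Type*} [Countable ι] (hp : 0 < p)
    {Γ : ι → Set (MetricPath Z)} (h : ∀ i, pathModulus μ p (Γ i) = 0) :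
    pathModulus μ p (⋃ i, Γ i) = 0 := by
  refine pathModulus_eq_zero_iff.2 fun ε hε => ?_
  obtain ⟨ε', hε', hsum⟩ := ENNReal.exists_pos_sum_of_countable hε.ne' ι
  choose ρ hadm hρ using fun i =>
    pathModulus_eq_zero_iff.1 (h i) (ε' i) (ENNReal.coe_pos.2 (hε' i))
  refine ⟨fun z => ⨆ i, ρ i z, ⟨Measurable.iSup fun i => (hadm i).1, fun γ hγ hrect => ?_⟩, ?_⟩
  · obtain ⟨i, hi⟩ := mem_iUnion.1 hγ
    exact ((hadm i).2 γ hi hrect).trans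
      (γ.lineIntegral_mono fun z => le_iSup (fun i => ρ i z) i)
  · exact ((lintegral_iSup_rpow_le_tsum hp fun i => (hadm i).1).trans
      (ENNReal.tsum_le_tsum hρ)).trans hsum.le

theorem pathModulus_eq_zero_of_le [IsFiniteMeasure μ] {q : ℝ} (hp : 0 < p) (hpq : p ≤ q)
    (h : pathModulus μ q Γ = 0) : pathModulus μ p Γ = 0 := by
  have hq : 0 < q := hp.trans_le hpq
  have hexp : 0 ≤ 1 / p - 1 / q := sub_nonneg.2 (one_div_le_one_div_of_le hp hpq)
  set K : ℝ≥0∞ := μ univ ^ (1 / p - 1 / q) with hK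
  have hbound : ∀ ε > 0, pathModulus μ p Γ ≤ (ε ^ (1 / q) * K) ^ p := fun ε hε => by
    obtain ⟨ρ, hadm, hρ⟩ := pathModulus_eq_zero_iff.1 h ε hε
    refine (iInf₂_le ρ hadm).trans ?_
    rw [← ENNReal.rpow_inv_le_iff hp, ← one_div]
    calc (∫⁻ z, ρ z ^ p ∂μ) ^ (1 / p) ≤ (∫⁻ z, ρ z ^ q ∂μ) ^ (1 / q) * K := by
          simpa [eLpNorm', hK] using eLpNorm'_le_eLpNorm'_mul_rpow_measure_univ (μ := μ) hp hpq
            hadm.1.aestronglyMeasurable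
      _ ≤ ε ^ (1 / q) * K := by gcongr
  have hlim : Tendsto (fun ε : ℝ≥0∞ => (ε ^ (1 / q) * K) ^ p) (𝓝[>] 0) (𝓝 0) := by
    refine Tendsto.mono_left ?_ nhdsWithin_le_nhds
    have hKtop : K ≠ ∞ := ENNReal.rpow_ne_top_of_nonneg hexp (measure_ne_top μ univ)
    refine Continuous.tendsto' ?_ _ _ (by simp [hp, hq])
    exact ENNReal.continuous_rpow_const.comp
      ((ENNReal.continuous_mul_const hKtop).comp ENNReal.continuous_rpow_const)
  exact le_antisymm (ge_of_tendsto hlim (eventually_mem_nhdsWithin.mono hbound)) zero_le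

theorem pathModulus_eq_zero_of_frequently_le_lineIntegral (hp : 0 < p) {ρ : ℕ → Z → ℝ≥0∞}
    (hρ : ∀ n, Measurable (ρ n)) (hsum : ∑' n, ∫⁻ z, ρ n z ^ p ∂μ ≠ ∞) {c : ℝ≥0∞} (hc : c ≠ 0)
    (hc' : c ≠ ∞) (h : ∀ γ ∈ Γ, γ.Rectifiable → ∃ᶠ n in atTop, c ≤ γ.lineIntegral (ρ n)) :
    pathModulus μ p Γ = 0 := by
  have hρ' : ∀ n, Measurable fun z => c⁻¹ * ρ n z := fun n => (hρ n).const_mul _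
  have hmul : ∀ n, ∫⁻ z, (c⁻¹ * ρ n z) ^ p ∂μ = c⁻¹ ^ p * ∫⁻ z, ρ n z ^ p ∂μ := fun n => by
    simp only [ENNReal.mul_rpow_of_nonneg _ _ hp.le]
    exact lintegral_const_mul _ ((hρ n).pow_const p)
  have hsum' : ∑' n, ∫⁻ z, (c⁻¹ * ρ n z) ^ p ∂μ ≠ ∞ := by
    simp only [hmul]
    rw [ENNReal.tsum_mul_left]
    exact ENNReal.mul_ne_top (ENNReal.rpow_ne_top_of_nonneg hp.le (ENNReal.inv_ne_top.2 hc)) hsum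
  refine pathModulus_eq_zero_iff.2 fun ε hε => ?_
  obtain ⟨N, hN⟩ := ((ENNReal.tendsto_sum_nat_add _ hsum').eventually_lt_const hε).exists
  refine ⟨fun z => ⨆ k, c⁻¹ * ρ (k + N) z, ⟨Measurable.iSup fun k => hρ' _, fun γ hγ hrect => ?_⟩,
    (lintegral_iSup_rpow_le_tsum hp fun k => hρ' (k + N)).trans hN.le⟩
  obtain ⟨n, hn, hnN⟩ := ((h γ hγ hrect).and_eventually (eventually_ge_atTop N)).exists
  obtain ⟨k, rfl⟩ := Nat.exists_eq_add_of_le' hnN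
  calc (1 : ℝ≥0∞) = c⁻¹ * c := (ENNReal.inv_mul_cancel hc hc').symm
    _ ≤ c⁻¹ * γ.lineIntegral (ρ (k + N)) := by gcongr
    _ = γ.lineIntegral fun z => c⁻¹ * ρ (k + N) z :=
      (lintegral_const_mul' _ _ (ENNReal.inv_ne_top.2 hc)).symm
    _ ≤ _ := γ.lineIntegral_mono fun z => le_iSup (fun k => c⁻¹ * ρ (k + N) z) k

theorem exists_ball_pathModulus_ne_zero [TopologicalSpace.SeparableSpace Z] (hp : 0 < p)
    (hΓ : ∀ γ ∈ Γ, γ.Nonconstant) (hpos : 0 < pathModulus μ p Γ) :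
    ∃ (a b : Z) (r : ℝ), 0 < r ∧ 0 < setDist (Metric.ball a r) (Metric.ball b r) ∧
      pathModulus μ p {γ | (γ.toFun '' γ.dom ∩ Metric.ball a r).Nonempty ∧
        (γ.toFun '' γ.dom ∩ Metric.ball b r).Nonempty} ≠ 0 := by
  by_contra! h
  obtain ⟨D, hDc, hD⟩ := TopologicalSpace.exists_countable_dense Z
  have := hDc.to_subtype
  let I := {i : D × D × ℕ // 0 < setDist (Metric.ball (i.1 : Z) (1 / (i.2.2 + 1 : ℝ)))
    (Metric.ball (i.2.1 : Z) (1 / (i.2.2 + 1 : ℝ)))}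
  refine hpos.ne' (le_antisymm ?_ zero_le)
  refine (pathModulus_mono fun γ hγ => ?_).trans_eq (pathModulus_iUnion_eq_zero hp
    fun i : I => h i.1.1 i.1.2.1 (1 / (i.1.2.2 + 1)) (by positivity) i.2)
  obtain ⟨x, hx, y, hy, hxy⟩ := (hΓ γ hγ).nontrivial_image
  have hxy0 : 0 < dist x y / 6 := div_pos (dist_pos.2 hxy) (by norm_num)
  obtain ⟨n, hn⟩ := exists_nat_one_div_lt hxy0
  have hr : 0 < 1 / (n + 1 : ℝ) := by positivity
  obtain ⟨a, haD, ha⟩ := hD.exists_dist_lt x hr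
  obtain ⟨b, hbD, hb⟩ := hD.exists_dist_lt y hr
  have hax : 1 / (n + 1 : ℝ) + dist a x ≤ dist x y / 3 := by rw [dist_comm a]; linarith
  have hby : 1 / (n + 1 : ℝ) + dist b y ≤ dist x y / 3 := by rw [dist_comm b]; linarith
  have hsep : 0 < setDist (Metric.ball a (1 / (n + 1 : ℝ))) (Metric.ball b (1 / (n + 1 : ℝ))) :=
    (setDist_ball_pos hxy).trans_le (biInf_mono (Metric.ball_subset_ball' hax) |>.trans
      (iInf₂_mono fun _ _ => biInf_mono (Metric.ball_subset_ball' hby)))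
  exact mem_iUnion.2 ⟨⟨(⟨a, haD⟩, ⟨b, hbD⟩, n), hsep⟩, ⟨x, hx, ha⟩, ⟨y, hy, hb⟩⟩

end Modulus

/-! ### Bi-infinite paths in a hyperbolic filling -/

namespace HyperbolicFilling

variable {Z : Type*} [MetricSpace Z] {X : HyperbolicFilling Z}

namespace TendstoNontangentially

variable {v : ℕ → X.Vertex} {z : Z}

theorem comp_tendsto (h : TendstoNontangentially v z) {φ : ℕ → ℕ} (hφ : Tendsto φ atTop atTop) :
    TendstoNontangentially (v ∘ φ) z := by
  obtain ⟨hcenter, hradius, C, hC, hdist⟩ := h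
  exact ⟨hcenter.comp hφ, hradius.comp hφ, C, hC, fun n => hdist (φ n)⟩

theorem of_succ (h : TendstoNontangentially (fun n => v (n + 1)) z) :
    TendstoNontangentially v z := by
  obtain ⟨hcenter, hradius, C, hC, hdist⟩ := h
  refine ⟨(tendsto_add_atTop_iff_nat 1).1 hcenter, (tendsto_add_atTop_iff_nat 1).1 hradius,
    max C (dist z (v 0).center / (v 0).radius), lt_max_of_lt_left hC, fun n => ?_⟩
  have hr := (v n).radius_pos
  cases n with
  | zero => exact (div_le_iff₀ hr).1 (le_max_right _ _)
  | succ n => exact (hdist n).trans (by gcongr; exact le_max_left _ _)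

end TendstoNontangentially

section Ray

variable (X)

/-- A choice of vertices of levels `0, 1, 2, …` whose balls contain `z`. -/
noncomputable def ray (z : Z) (k : ℕ) : X.Vertex := (X.exists_vertex_dist_lt k z).choose

theorem level_ray (z : Z) (k : ℕ) : (X.ray z k).level = k :=
  (X.exists_vertex_dist_lt k z).choose_spec.1

theorem dist_center_ray_lt (z : Z) (k : ℕ) : dist z (X.ray z k).center < X.mesh k :=
  (X.exists_vertex_dist_lt k z).choose_spec.2

theorem radius_ray (z : Z) (k : ℕ) : (X.ray z k).radius = 2 * X.mesh k := by
  rw [Vertex.radius_eq, level_ray]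

theorem mem_ball_ray (z : Z) (k : ℕ) : z ∈ (X.ray z k).ball := by
  rw [Vertex.ball, Metric.mem_ball, radius_ray]
  linarith [X.dist_center_ray_lt z k, X.mesh_pos k]

theorem adj_ray (z : Z) (k : ℕ) : X.graph.Adj (X.ray z k) (X.ray z (k + 1)) := by
  refine adj_of_mem_ball (fun h => ?_) ?_ ?_ (X.mem_ball_ray z k) (X.mem_ball_ray z (k + 1))
  · simpa only [level_ray, left_eq_add, one_ne_zero] using congrArg Vertex.level h
  all_goals simp only [level_ray]; omega

theorem tendstoNontangentially_ray (z : Z) : TendstoNontangentially (X.ray z) z := by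
  refine ⟨tendsto_iff_dist_tendsto_zero.2 (squeeze_zero (fun _ => dist_nonneg) (fun k => ?_)
    X.tendsto_mesh), ?_, 1, one_pos, fun k => ?_⟩
  · rw [dist_comm]
    exact (X.dist_center_ray_lt z k).le
  · simpa only [radius_ray, mul_zero] using X.tendsto_mesh.const_mul 2
  · rw [one_mul]
    exact (Metric.mem_ball.1 (X.mem_ball_ray z k)).le

end Ray

theorem exists_prepend_walk {u w : X.Vertex} (p : X.graph.Walk u w) {y : ℕ → X.Vertex}
    (hyw : y 0 = w) (hy : ∀ k, X.graph.Adj (y k) (y (k + 1))) {z : Z}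
    (hyz : TendstoNontangentially y z) (f : X.Vertex → ℝ≥0∞) :
    ∃ x : ℕ → X.Vertex, x 0 = u ∧ (∀ k, X.graph.Adj (x k) (x (k + 1))) ∧
      TendstoNontangentially x z ∧ ∑' k, f (x k) ≤ (p.support.map f).sum + ∑' k, f (y k) := by
  induction p with
  | nil => exact ⟨y, hyw, hy, hyz, le_add_self⟩
  | @cons u _ _ huv p ih =>
    obtain ⟨x, hx0, hx, hxz, hsum⟩ := ih hyw
    refine ⟨fun k => k.casesOn u x, rfl, fun k => ?_, hxz.of_succ, ?_⟩
    · cases k with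
      | zero => exact (congrArg (X.graph.Adj u) hx0).mpr huv
      | succ k => exact hx k
    · rw [tsum_eq_zero_add' ENNReal.summable, SimpleGraph.Walk.support_cons, List.map_cons,
        List.sum_cons, add_assoc]
      exact add_le_add_right hsum (f u)

/-- The supremum of an edge function over the edges at a vertex. -/
noncomputable def vertexSup (τ : X.graph.edgeSet → ℝ≥0∞) (v : X.Vertex) : ℝ≥0∞ :=
  ⨆ e : {e : X.graph.edgeSet // v ∈ e.1}, τ e

theorem le_vertexSup {τ : X.graph.edgeSet → ℝ≥0∞} {v : X.Vertex} {e : X.graph.edgeSet}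
    (h : v ∈ e.1) : τ e ≤ vertexSup τ v :=
  le_iSup (fun e : {e : X.graph.edgeSet // v ∈ e.1} => τ e) ⟨e, h⟩

theorem tsum_vertexSup_rpow_le (τ : X.graph.edgeSet → ℝ≥0∞) {p : ℝ} (hp : 0 < p) :
    ∑' v, vertexSup τ v ^ p ≤ 2 * ∑' e, τ e ^ p := by
  let I := Σ v : X.Vertex, {e : X.graph.edgeSet // v ∈ e.1}
  have hfibre : ∀ e, ((fun i : I => i.2.1) ⁻¹' {e}).encard ≤ (2 : ℕ) := by
    rintro ⟨e, he⟩
    refine (encard_le_encard_of_injOn (t := {v | v ∈ e}) (f := fun i : I => i.1) ?_ ?_).trans ?_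
    · rintro ⟨v, e', hv⟩ rfl
      exact hv
    · rintro ⟨v, e', hv⟩ rfl ⟨w, e'', hw⟩ h rfl
      obtain rfl : e'' = _ := h
      rfl
    · induction e using Sym2.ind with
      | h v w =>
        rw [show {u | u ∈ s(v, w)} = {v, w} by ext; simp]
        exact (encard_insert_le _ _).trans_eq (by rw [encard_singleton]; norm_num)
  calc ∑' v, vertexSup τ v ^ p ≤ ∑' v, ∑' e : {e : X.graph.edgeSet // v ∈ e.1}, τ e ^ p :=
        ENNReal.tsum_le_tsum fun v => iSup_rpow_le_tsum_rpow _ hp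
    _ = ∑' i : I, τ i.2 ^ p := (ENNReal.tsum_sigma' fun i : I => τ i.2 ^ p).symm
    _ ≤ 2 * ∑' e, τ e ^ p := tsum_comp_le_of_encard_preimage_le hfibre fun e => τ e ^ p

theorem IsAdmissible.one_le_tsum_add_tsum {A B : Set Z} {τ : X.graph.edgeSet → ℝ≥0∞}
    (hτ : X.IsAdmissible A B τ) {a b : Z} (ha : a ∈ A) (hb : b ∈ B) {x y : ℕ → X.Vertex}
    (hx : ∀ k, X.graph.Adj (x k) (x (k + 1))) (hxa : TendstoNontangentially x a)
    (hy : ∀ k, X.graph.Adj (y k) (y (k + 1))) (hyb : TendstoNontangentially y b)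
    (hxy : x 0 = y 0) : 1 ≤ ∑' k, vertexSup τ (x k) + ∑' k, vertexSup τ (y k) := by
  set v : ℤ → X.Vertex := fun k => if 0 ≤ k then y k.toNat else x (-k).toNat with hv
  have hvy : ∀ n : ℕ, v n = y n := fun n => by simp [hv]
  have hvx : ∀ n : ℕ, v (-n) = x n := fun n => by
    cases n with
    | zero => simpa [hv] using hxy.symm
    | succ n => simp [hv, show ¬(n : ℤ) ≤ -1 by omega]
  clear_value v
  have hsucc : ∀ n : ℕ, -((n : ℤ) + 1) + 1 = -n := fun n => by ring
  have hadj : ∀ k, X.graph.Adj (v k) (v (k + 1)) := fun k => by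
    rcases k with n | n
    · simpa only [hvy, Int.ofNat_eq_natCast, ← Nat.cast_succ] using hy n
    · rw [Int.negSucc_eq, hsucc, hvx, ← Nat.cast_succ, hvx]
      exact (hx n).symm
  have hone := hτ v hadj a ha b hb (by simpa only [hvx] using hxa) (by simpa only [hvy] using hyb)
  rw [tsum_of_nat_of_neg_add_one ENNReal.summable ENNReal.summable, add_comm] at hone
  refine hone.trans (add_le_add (ENNReal.tsum_le_tsum fun n => ?_)
    (ENNReal.tsum_le_tsum fun n => ?_))
  · rw [← hvx, ← hsucc]
    exact le_vertexSup (Sym2.mem_mk_right _ _)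
  · rw [← hvy]
    exact le_vertexSup (Sym2.mem_mk_left _ _)

theorem IsAdmissible.one_le_sum_support_add_tsum_ray {A B : Set Z} {τ : X.graph.edgeSet → ℝ≥0∞}
    (hτ : X.IsAdmissible A B τ) {a b : Z} (ha : a ∈ A) (hb : b ∈ B) {n : ℕ}
    (p : X.graph.Walk (X.ray a n) (X.ray b n)) :
    1 ≤ (p.support.map (vertexSup τ)).sum +
      (∑' k, vertexSup τ (X.ray a (k + n)) + ∑' k, vertexSup τ (X.ray b (k + n))) := by
  have hadj : ∀ z k, X.graph.Adj (X.ray z (k + n)) (X.ray z (k + 1 + n)) := fun z k => by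
    rw [add_right_comm]
    exact X.adj_ray z (k + n)
  have hlim : ∀ z, TendstoNontangentially (fun k => X.ray z (k + n)) z := fun z =>
    (X.tendstoNontangentially_ray z).comp_tendsto (tendsto_add_atTop_nat n)
  obtain ⟨y, hy0, hy, hyb, hsum⟩ := exists_prepend_walk p (y := fun k => X.ray b (k + n))
    (by rw [zero_add]) (hadj b) (hlim b) (vertexSup τ)
  rw [add_left_comm]
  refine (hτ.one_le_tsum_add_tsum ha hb (hadj a) (hlim a) hy hyb ?_).trans (by gcongr)
  rw [hy0, zero_add]

/-! ### Chains of vertices along a connected set -/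

variable (X) in
theorem preconnected_induce_of_isPreconnected {E : Set Z} (hE : IsPreconnected E) (n : ℕ) :
    (X.graph.induce {v | v.level = n ∧ (E ∩ v.ball).Nonempty}).Preconnected := by
  set W := {v : X.Vertex | v.level = n ∧ (E ∩ v.ball).Nonempty}
  intro v w
  by_contra hvw
  set C : Set W := {u | (X.graph.induce W).Reachable v u}
  have hopen : ∀ S : Set W, IsOpen (⋃ u ∈ S, u.1.ball) := fun S =>
    isOpen_biUnion fun _ _ => Metric.isOpen_ball
  have hcover : E ⊆ (⋃ u ∈ C, u.1.ball) ∪ ⋃ u ∈ Cᶜ, u.1.ball := fun z hz => by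
    let u : W := ⟨X.ray z n, X.level_ray z n, z, hz, X.mem_ball_ray z n⟩
    rcases em (u ∈ C) with hu | hu
    · exact .inl (mem_biUnion hu (X.mem_ball_ray z n))
    · exact .inr (mem_biUnion (mem_compl hu) (X.mem_ball_ray z n))
  have hmeet : ∀ {S : Set W}, ∀ u ∈ S, (E ∩ ⋃ u ∈ S, u.1.ball).Nonempty := fun u hu =>
    u.2.2.mono (inter_subset_inter_right _ fun _ hz => mem_biUnion hu hz)
  obtain ⟨z, -, hz, hz'⟩ := hE _ _ (hopen C) (hopen Cᶜ) hcover (hmeet v (.refl v)) (hmeet w hvw)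
  obtain ⟨u, hu, hzu⟩ := mem_iUnion₂.1 hz
  obtain ⟨u', hu', hzu'⟩ := mem_iUnion₂.1 hz'
  have hlevel : u.1.level = u'.1.level := u.2.1.trans u'.2.1.symm
  have hadj : X.graph.Adj u u' := adj_of_mem_ball (fun h => hu' (Subtype.ext h ▸ hu))
    (by omega) (by omega) hzu hzu'
  exact hu' (SimpleGraph.Reachable.trans hu
    (SimpleGraph.Adj.reachable (SimpleGraph.induce_adj.2 hadj)))

theorem exists_isPath_of_isPreconnected {E : Set Z} (hE : IsPreconnected E) {a b : Z} (ha : a ∈ E)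
    (hb : b ∈ E) (n : ℕ) : ∃ p : X.graph.Walk (X.ray a n) (X.ray b n), p.IsPath ∧
      ∀ u ∈ p.support, u.level = n ∧ (E ∩ u.ball).Nonempty := by
  classical
  set W := {v : X.Vertex | v.level = n ∧ (E ∩ v.ball).Nonempty}
  obtain ⟨p⟩ := X.preconnected_induce_of_isPreconnected hE n
    ⟨X.ray a n, X.level_ray a n, a, ha, X.mem_ball_ray a n⟩
    ⟨X.ray b n, X.level_ray b n, b, hb, X.mem_ball_ray b n⟩
  refine ⟨p.toPath.1.map (SimpleGraph.Embedding.induce W).toHom,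
    p.toPath.2.map Subtype.val_injective, fun u hu => ?_⟩
  obtain ⟨u, -, rfl⟩ := List.mem_map.1 (SimpleGraph.Walk.support_map _ p.toPath.1 ▸ hu)
  exact u.2

/-! ### The modulus of the paths joining two sets -/

section Modulus

variable [MeasurableSpace Z] [BorelSpace Z]

variable (X) in
/-- The exceptional set is covered infinitely often by the balls of the vertices `v` with
`m v ^ p > R s⁻ᵏ`, where `k` is the level of `v`, and these balls have summable diameters. -/
theorem ae_hausdorffMeasure_tendsto_tsum_ray [Countable X.Vertex] {p : ℝ} (hp : 0 < p)
    {m : X.Vertex → ℝ≥0∞} (hm : ∑' v, m v ^ p ≠ ∞) :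
    ∀ᵐ z ∂(μH[1] : Measure Z), Tendsto (fun n => ∑' k, m (X.ray z (k + n))) atTop (𝓝 0) := by
  classical
  set U : X.Vertex → Set Z := fun v =>
    if ENNReal.ofReal (X.mesh v.level) < m v ^ p then v.ball else ∅ with hU
  have hdiam : ∀ v, Metric.ediam (U v) ^ (1 : ℝ) ≤ 4 * m v ^ p := fun v => by
    rw [ENNReal.rpow_one]
    by_cases hv : ENNReal.ofReal (X.mesh v.level) < m v ^ p
    · calc Metric.ediam (U v) = Metric.ediam v.ball := by rw [hU]; simp only [hv, if_true]
        _ ≤ ENNReal.ofReal (2 * (2 * X.mesh v.level)) := ediam_ball_le_ofReal _ _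
        _ = 4 * ENNReal.ofReal (X.mesh v.level) := by
          rw [← mul_assoc, ENNReal.ofReal_mul (by norm_num)]
          norm_num
        _ ≤ 4 * m v ^ p := by gcongr
    · simp [hU, hv]
  have hsum : ∑' v, Metric.ediam (U v) ^ (1 : ℝ) ≠ ∞ := by
    refine ne_top_of_le_ne_top ?_ (ENNReal.tsum_le_tsum hdiam)
    rw [ENNReal.tsum_mul_left]
    finiteness
  have hnull := hausdorffMeasure_setOf_frequently_mem_eq_zero one_pos U hsum
  have hinv : 0 < p⁻¹ := inv_pos.2 hp
  filter_upwards [measure_eq_zero_iff_ae_notMem.1 hnull] with z hz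
  have hinj : Function.Injective (X.ray z) := fun k l h => by
    rw [← X.level_ray z k, h, X.level_ray]
  have hle : ∀ᶠ k in atTop, m (X.ray z k) ≤ ENNReal.ofReal (X.mesh k) ^ p⁻¹ := by
    rw [← Nat.cofinite_eq_atTop]
    filter_upwards [hinj.tendsto_cofinite.eventually (not_frequently.1 hz)] with k hk
    rw [ENNReal.le_rpow_inv_iff hp]
    by_contra! hlt
    exact hk (by rw [hU]; simp only [level_ray, hlt, if_true, mem_ball_ray])
  refine tendsto_of_tendsto_of_tendsto_of_le_of_le' tendsto_const_nhds
    (ENNReal.tendsto_sum_nat_add _ (X.tsum_ofReal_mesh_rpow_ne_top hinv)) (.of_forall fun _ =>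
      zero_le) ?_
  filter_upwards [eventually_forall_ge_atTop.2 hle] with n hn
  exact ENNReal.tsum_le_tsum fun k => hn (k + n) (Nat.le_add_left n k)

theorem IsAdmissible.one_le_lineIntegral_add_tsum_ray {A B : Set Z} {τ : X.graph.edgeSet → ℝ≥0∞}
    (hτ : X.IsAdmissible A B τ) {γ : MetricPath Z} (hγ : γ.Rectifiable) {a b : Z}
    (ha : a ∈ γ.toFun '' γ.dom) (hb : b ∈ γ.toFun '' γ.dom) (haA : a ∈ A) (hbB : b ∈ B) {n : ℕ}
    (hn : 8 * X.mesh n ≤ dist a b) {F : Finset X.Vertex} (hF : ∀ v, v.level = n → v ∈ F) :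
    1 ≤ γ.lineIntegral (ballDensity F Vertex.center Vertex.radius (vertexSup τ)) +
      (∑' k, vertexSup τ (X.ray a (k + n)) + ∑' k, vertexSup τ (X.ray b (k + n))) := by
  classical
  obtain ⟨p, hp, hsupp⟩ := exists_isPath_of_isPreconnected γ.isPreconnected_image ha hb n
  refine (hτ.one_le_sum_support_add_tsum_ray haA hbB p).trans (add_le_add_left ?_ _)
  rw [← List.sum_toFinset _ hp.support_nodup]
  refine hγ.sum_le_lineIntegral_ballDensity (fun v hv => ?_) (fun v _ => v.radius_pos)
    (fun v hv => ?_) fun v hv => ?_ <;>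
    obtain ⟨hlevel, y, hy, hyv⟩ := hsupp v (List.mem_toFinset.1 hv)
  · exact hF v hlevel
  · exact ⟨y, hy, (Metric.mem_ball'.1 hyv).le⟩
  · by_contra! hlt
    have hradius : v.radius = 2 * X.mesh n := by rw [v.radius_eq, hlevel]
    linarith [hlt a ha, hlt b hb, dist_triangle_left a b v.center]

theorem IsAdmissible.eventually_half_le_lineIntegral {A B : Set Z} {τ : X.graph.edgeSet → ℝ≥0∞}
    (hτ : X.IsAdmissible A B τ) {γ : MetricPath Z} (hγ : γ.Rectifiable) {a b : Z}
    (ha : a ∈ γ.toFun '' γ.dom) (hb : b ∈ γ.toFun '' γ.dom) (haA : a ∈ A) (hbB : b ∈ B)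
    (hab : a ≠ b)
    (hlima : Tendsto (fun n => ∑' k, vertexSup τ (X.ray a (k + n))) atTop (𝓝 0))
    (hlimb : Tendsto (fun n => ∑' k, vertexSup τ (X.ray b (k + n))) atTop (𝓝 0))
    {F : ℕ → Finset X.Vertex} (hF : ∀ v, v ∈ F v.level) :
    ∀ᶠ n in atTop,
      1 / 2 ≤ γ.lineIntegral (ballDensity (F n) Vertex.center Vertex.radius (vertexSup τ)) := by
  have htails := hlima.add hlimb
  have hmesh := X.tendsto_mesh.const_mul 8
  rw [add_zero] at htails
  rw [mul_zero] at hmesh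
  filter_upwards [htails.eventually_le_const (show (0 : ℝ≥0∞) < 1 / 2 by simp),
    hmesh.eventually_le_const (dist_pos.2 hab)] with n htail hn
  have hone := hτ.one_le_lineIntegral_add_tsum_ray hγ ha hb haA hbB hn
    fun v hv => hv ▸ hF v
  rw [← ENNReal.add_halves 1] at hone
  exact (ENNReal.add_le_add_iff_right (by simp)).1 (hone.trans (add_le_add_right htail _))

variable [Nontrivial Z] {μ : Measure Z} [IsFiniteMeasure μ] {Q : ℝ}

variable (X) in
theorem exists_tsum_lintegral_ballDensity_rpow_le (hQ : 1 ≤ Q) (hμ : IsAhlforsRegular μ Q)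
    {F : ℕ → Finset X.Vertex} (hF : ∀ n v, v ∈ F n ↔ v.level = n) :
    ∃ K : ℝ≥0∞, K ≠ ∞ ∧ ∀ m : X.Vertex → ℝ≥0∞,
      ∑' n, ∫⁻ z, ballDensity (F n) Vertex.center Vertex.radius m z ^ Q ∂μ ≤ K * ∑' v, m v ^ Q := by
  have hQ0 : 0 < Q := one_pos.trans_le hQ
  obtain ⟨C, -, hC⟩ := hμ.exists_measure_ball_le hQ0
  obtain ⟨M, hM⟩ := X.exists_encard_vertex_le hQ0 hμ (K := 4) (by norm_num)
  refine ⟨(M : ℝ≥0∞) ^ (Q - 1) * ENNReal.ofReal (C * 2 ^ Q), ENNReal.mul_ne_top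
    (ENNReal.rpow_ne_top_of_nonneg (sub_nonneg.2 hQ) (ENNReal.natCast_ne_top M))
    ENNReal.ofReal_ne_top, fun m => ?_⟩
  have hlevel : ∀ n, ∑ v ∈ F n, m v ^ Q = ∑' v : ↥(Vertex.level ⁻¹' {n}), m v.1 ^ Q := fun n => by
    rw [← Finset.tsum_subtype' (F n) fun v => m v ^ Q,
      show (F n : Set X.Vertex) = Vertex.level ⁻¹' {n} from Set.ext (hF n)]
  rw [← ENNReal.tsum_fiberwise _ Vertex.level, ← ENNReal.tsum_mul_left]
  refine ENNReal.tsum_le_tsum fun n => (lintegral_ballDensity_rpow_le hQ hC (M := M) (fun z => ?_)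
    fun v _ => v.radius_pos).trans_eq (congrArg _ (hlevel n))
  refine (encard_le_encard ?_).trans (hM n z)
  rintro v ⟨hv, hvz⟩
  obtain rfl := (hF n v).1 hv
  refine ⟨rfl, hvz.trans_eq ?_⟩
  rw [v.radius_eq]
  ring

theorem IsAdmissible.pathModulus_eq_zero (hQ : 1 ≤ Q) (hμ : IsAhlforsRegular μ Q) {A B : Set Z}
    (hA : IsOpen A) (hB : IsOpen B) (hAB : 0 < setDist A B) {τ : X.graph.edgeSet → ℝ≥0∞}
    (hτ : X.IsAdmissible A B τ) (hsum : ∑' e, τ e ^ Q ≠ ∞) :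
    pathModulus μ Q {γ | (γ.toFun '' γ.dom ∩ A).Nonempty ∧ (γ.toFun '' γ.dom ∩ B).Nonempty} =
      0 := by
  have hQ0 : 0 < Q := one_pos.trans_le hQ
  have := X.countable_vertex hμ
  have hmem : ∀ n v, v ∈ (X.finite_level hμ n).toFinset ↔ v.level = n := fun n _ =>
    (X.finite_level hμ n).mem_toFinset
  have hsumV : ∑' v, vertexSup τ v ^ Q ≠ ∞ :=
    ne_top_of_le_ne_top (by finiteness) (tsum_vertexSup_rpow_le τ hQ0)
  obtain ⟨K, hK, hle⟩ := X.exists_tsum_lintegral_ballDensity_rpow_le hQ hμ hmem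
  have hae := X.ae_hausdorffMeasure_tendsto_tsum_ray hQ0 hsumV
  refine pathModulus_eq_zero_of_frequently_le_lineIntegral hQ0 (fun n => measurable_ballDensity)
    (ne_top_of_le_ne_top (ENNReal.mul_ne_top hK hsumV) (hle (vertexSup τ))) (c := 1 / 2)
    (by simp) (by simp) fun γ hγ hrect => Eventually.frequently ?_
  have hdist : ∀ a ∈ A, ∀ b ∈ B, a ≠ b := by
    rintro a ha _ hb rfl
    exact hAB.not_ge ((iInf₂_le_of_le a ha (iInf₂_le a hb)).trans_eq (edist_self a))
  have hnontrivial : (γ.toFun '' γ.dom).Nontrivial := by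
    obtain ⟨⟨a, ha, haA⟩, b, hb, hbB⟩ := hγ
    exact ⟨a, ha, b, hb, hdist a haA b hbB⟩
  have hgood : ∀ U : Set Z, IsOpen U → (γ.toFun '' γ.dom ∩ U).Nonempty →
      ∃ z ∈ γ.toFun '' γ.dom ∩ U,
        Tendsto (fun n => ∑' k, vertexSup τ (X.ray z (k + n))) atTop (𝓝 0) := fun U hU hγU =>
    ((frequently_ae_mem_iff.2 (hausdorffMeasure_one_inter_pos_of_isPreconnected
      γ.isPreconnected_image hnontrivial hU hγU).ne').and_eventually hae).exists
  obtain ⟨a, ⟨ha, haA⟩, hlima⟩ := hgood A hA hγ.1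
  obtain ⟨b, ⟨hb, hbB⟩, hlimb⟩ := hgood B hB hγ.2
  exact hτ.eventually_half_le_lineIntegral hrect ha hb haA hbB (hdist a haA b hbB) hlima hlimb
    fun v => (hmem _ v).2 rfl

end Modulus

end HyperbolicFilling

/-! ### Conformal dimension and the critical exponent -/

section ConformalDimension

variable {Z : Type*} [MetricSpace Z] [MeasurableSpace Z] {μ : Measure Z} {Q : ℝ}

theorem nontrivial_of_pathModulus_pos {p : ℝ} (hp : 0 < p) {Γ : Set (MetricPath Z)}
    (hΓ : ∀ γ ∈ Γ, γ.Nonconstant) (hpos : 0 < pathModulus μ p Γ) : Nontrivial Z := by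
  obtain ⟨γ, hγ⟩ := nonempty_of_pathModulus_pos hp hpos
  obtain ⟨t, -, t', -, hne⟩ := hΓ γ hγ
  exact ⟨_, _, hne⟩

variable [BorelSpace Z]

theorem IsAhlforsRegular.isAhlforsRegularSpace (hQ : 0 < Q) (hμ : IsAhlforsRegular μ Q) :
    IsAhlforsRegularSpace Z := by
  obtain rfl : ‹MeasurableSpace Z› = borel Z := BorelSpace.measurable_eq
  exact ⟨Q, μ, hQ, hμ⟩

variable [IsFiniteMeasure μ]

theorem IsAhlforsRegular.one_le_of_pathModulus_pos (hμ : IsAhlforsRegular μ Q) (hQ : 0 < Q) {p : ℝ}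
    (hp : 0 < p) {Γ : Set (MetricPath Z)} (hΓ : ∀ γ ∈ Γ, γ.Nonconstant)
    (hpos : 0 < pathModulus μ p Γ) : 1 ≤ Q := by
  have := nontrivial_of_pathModulus_pos hp hΓ hpos
  obtain ⟨γ, hγ⟩ := nonempty_of_pathModulus_pos hp hpos
  exact ENNReal.one_le_ofReal.1 ((one_le_dimH_univ_of_isPreconnected γ.isPreconnected_image
    (hΓ γ hγ).nontrivial_image).trans (hμ.dimH_le hQ))

variable [Nontrivial Z]

theorem HyperbolicFilling.wcap_eq_top_of_pathModulus_ne_zero (X : HyperbolicFilling Z)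
    (hQ : 1 ≤ Q) (hμ : IsAhlforsRegular μ Q) {A B : Set Z} (hA : IsOpen A) (hB : IsOpen B)
    (hAB : 0 < setDist A B) (hmod : pathModulus μ Q
      {γ | (γ.toFun '' γ.dom ∩ A).Nonempty ∧ (γ.toFun '' γ.dom ∩ B).Nonempty} ≠ 0)
    {q : ℝ} (hq : 0 < q) (hqQ : q < Q) : X.wcap q A B = ∞ := by
  refine iInf₂_eq_top.2 fun τ hτ => ?_
  by_contra hne
  have hweak : weakNorm q τ ≠ ∞ := fun h => hne (by rw [h, ENNReal.top_rpow_of_pos hq])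
  exact hmod (hτ.pathModulus_eq_zero hQ hμ hA hB hAB
    (tsum_rpow_ne_top_of_weakNorm_ne_top hq hqQ hweak))

theorem IsAhlforsRegular.boundedSpace (hμ : IsAhlforsRegular μ Q) : BoundedSpace Z :=
  Bornology.isBounded_univ.1 hμ.totallyBounded_univ.isBounded

theorem IsQuasisymmetry.totallyBounded_univ {Y : Type*} [MetricSpace Y] {f : Z → Y}
    (hf : IsQuasisymmetry f) (hsurj : Function.Surjective f) (hQ : 0 < Q)
    (hμ : IsAhlforsRegular μ Q) : TotallyBounded (univ : Set Y) := by
  have := hμ.boundedSpace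
  obtain ⟨C, α, hα, hfα⟩ := hf.exists_holderWith (hμ.isUniformlyPerfect hQ)
  rw [← image_univ_of_surjective hsurj]
  exact hμ.totallyBounded_univ.image (hfα.uniformContinuous hα)

theorem ofReal_le_dimH_of_isQuasisymmetry {Y : Type*} [MetricSpace Y] (hQ : 0 < Q)
    (hμ : IsAhlforsRegular μ Q) (X : HyperbolicFilling Z) {A B : Set Z} (hAB : 0 < setDist A B)
    (hw : ∀ q : ℝ, 0 < q → q < Q → X.wcap q A B = ∞) {f : Z → Y} (hf : IsQuasisymmetry f)
    (hbij : Function.Bijective f) (hY : IsAhlforsRegularSpace Y) :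
    ENNReal.ofReal Q ≤ dimH (univ : Set Y) := by
  let : MeasurableSpace Y := borel Y
  have : BorelSpace Y := ⟨rfl⟩
  have := hμ.boundedSpace
  have := hbij.1.nontrivial
  obtain ⟨Q', ν, hQ', hν⟩ := hY
  have := hν.isFiniteMeasure (hf.totallyBounded_univ hbij.2 hQ hμ)
  obtain ⟨M, hM⟩ := X.exists_encard_adj_le hQ hμ
  refine le_trans (ENNReal.ofReal_le_ofReal ?_) (hν.le_dimH hQ')
  by_contra! hlt
  obtain ⟨q, hq, hqQ⟩ := exists_between hlt
  exact (X.wcap_lt_top_of_isQuasisymmetry (hμ.isUniformlyPerfect hQ) hM hQ' hν hf hbij hq hAB).ne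
    (hw q (hQ'.trans hq) hqQ)

theorem arConformalDim_eq (hQ : 0 < Q) (hμ : IsAhlforsRegular μ Q) (X : HyperbolicFilling Z)
    {A B : Set Z} (hAB : 0 < setDist A B)
    (hw : ∀ q : ℝ, 0 < q → q < Q → X.wcap q A B = ∞) :
    arConformalDim Z = ENNReal.ofReal Q := by
  -- Stated for a second space, so that the metric of `Y` does not compete with the one of `Z`.
  have hle : ∀ {Y : Type _} [MetricSpace Y] (f : Z → Y), IsQuasisymmetry f →
      Function.Bijective f → IsAhlforsRegularSpace Y → ENNReal.ofReal Q ≤ dimH (univ : Set Y) :=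
    fun _ hf hbij hY => ofReal_le_dimH_of_isQuasisymmetry hQ hμ X hAB hw hf hbij hY
  refine le_antisymm ?_ (le_iInf fun θ => le_iInf₂ fun hqs hreg =>
    @hle Z θ id hqs Function.bijective_id hreg)
  exact iInf_le_of_le _ (iInf₂_le_of_le (IsQuasisymmetry.id Z) (hμ.isAhlforsRegularSpace hQ)
    (hμ.dimH_le hQ))

theorem HyperbolicFilling.Qw_eq (hQ : 0 < Q) (hμ : IsAhlforsRegular μ Q) (X : HyperbolicFilling Z)
    {A B : Set Z} (hA : IsOpen A) (hB : IsOpen B) (hAB : 0 < setDist A B)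
    (hw : ∀ q : ℝ, 0 < q → q < Q → X.wcap q A B = ∞) : X.Qw = ENNReal.ofReal Q := by
  have := hμ.boundedSpace
  obtain ⟨M, hM⟩ := X.exists_encard_adj_le hQ hμ
  refine le_antisymm ?_ (le_iInf₂ fun q hq => ENNReal.ofReal_le_ofReal ?_)
  · have hlim : Tendsto ENNReal.ofReal (𝓝[>] Q) (𝓝 (ENNReal.ofReal Q)) :=
      (ENNReal.continuous_ofReal.tendsto Q).mono_left nhdsWithin_le_nhds
    refine ge_of_tendsto hlim (eventually_nhdsWithin_of_forall fun q hq => ?_)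
    exact iInf₂_le q ⟨hQ.trans hq, fun A B _ _ hAB => X.wcap_lt_top_of_isQuasisymmetry
      (hμ.isUniformlyPerfect hQ) hM hQ hμ (.id Z) Function.bijective_id hq hAB⟩
  · by_contra! hlt
    exact (hq.2 A B hA hB hAB).ne (hw q hq.1 hlt)

end ConformalDimension

theorem mainTheorem9_general {Z : Type*} [MetricSpace Z] [MeasurableSpace Z] [BorelSpace Z]
    (μ : Measure Z) [IsFiniteMeasure μ] (Q : ℝ) (hμ : IsAhlforsRegular μ Q) {p : ℝ} (hp : 0 < p)
    (hpQ : p ≤ Q) {Γ : Set (MetricPath Z)} (hΓ : ∀ γ ∈ Γ, γ.Nonconstant)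
    (hpos : 0 < pathModulus μ p Γ) :
    (∃ (a b : Z) (r r' : ℝ), 0 < r ∧ 0 < r' ∧
      0 < setDist (Metric.ball a r) (Metric.ball b r') ∧
      ∀ (X : HyperbolicFilling Z) (q : ℝ), 0 < q → q < Q →
        X.wcap q (Metric.ball a r) (Metric.ball b r') = ∞) ∧
    arConformalDim Z = ENNReal.ofReal Q ∧
    ∀ X : HyperbolicFilling Z, X.Qw = arConformalDim Z := by
  have hQ0 : 0 < Q := hp.trans_le hpQ
  have hQ : 1 ≤ Q := hμ.one_le_of_pathModulus_pos hQ0 hp hΓ hpos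
  have := nontrivial_of_pathModulus_pos hp hΓ hpos
  have := hμ.boundedSpace
  have := TopologicalSpace.isSeparable_univ_iff.1 hμ.totallyBounded_univ.isSeparable
  obtain ⟨a, b, r, hr, hab, hmod⟩ := exists_ball_pathModulus_ne_zero hp hΓ hpos
  have hw : ∀ (X : HyperbolicFilling Z) (q : ℝ), 0 < q → q < Q →
      X.wcap q (Metric.ball a r) (Metric.ball b r) = ∞ := fun X q =>
    X.wcap_eq_top_of_pathModulus_ne_zero hQ hμ Metric.isOpen_ball Metric.isOpen_ball hab
      fun h => hmod (pathModulus_eq_zero_of_le hp hpQ h)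
  obtain ⟨X₀⟩ := exists_hyperbolicFilling Z
  have hdim : arConformalDim Z = ENNReal.ofReal Q := arConformalDim_eq hQ0 hμ X₀ hab (hw X₀)
  refine ⟨⟨a, b, r, r, hr, hr, hab, hw⟩, hdim, fun X => ?_⟩
  rw [hdim, X.Qw_eq hQ0 hμ Metric.isOpen_ball Metric.isOpen_ball hab (hw X)]

theorem mainTheorem9 {Z : Type*} [MetricSpace Z] [CompactSpace Z] [ConnectedSpace Z]
    [MeasurableSpace Z] [BorelSpace Z] (μ : Measure Z) (Q : ℝ) (hQ : 1 < Q)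
    (hμ : IsAhlforsRegular μ Q)
    (hΓ : ∃ p : ℝ, 1 ≤ p ∧ p ≤ Q ∧ ∃ Γ : Set (MetricPath Z),
      (∀ γ ∈ Γ, γ.Nonconstant) ∧ 0 < pathModulus μ p Γ) :
    (∃ (a b : Z) (r r' : ℝ), 0 < r ∧ 0 < r' ∧
      0 < setDist (Metric.ball a r) (Metric.ball b r') ∧
      ∀ (X : HyperbolicFilling Z) (q : ℝ), 0 < q → q < Q →
        X.wcap q (Metric.ball a r) (Metric.ball b r') = ∞) ∧
    arConformalDim Z = ENNReal.ofReal Q ∧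
    ∀ X : HyperbolicFilling Z, X.Qw = arConformalDim Z := by
  obtain ⟨p, hp, hpQ, Γ, hnc, hpos⟩ := hΓ
  have := nontrivial_of_pathModulus_pos (one_pos.trans_le hp) hnc hpos
  have := hμ.isFiniteMeasure isCompact_univ.totallyBounded
  exact mainTheorem9_general μ Q hμ (one_pos.trans_le hp) hpQ hnc hpos
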